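/- Let $\mathfrak g$ be a finite-dimensional simple complex Lie algebra of rank $l$ with Cartan matrix $(A_{ij})$, simple roots $\alpha_i$, and invariant form normalized so that long roots have square length $2$; thus $(\alpha_i|\alpha_j)=d_iA_{ij}$ with $d_i=(\alpha_i|\alpha_i)/2$. Let $q=e^{\hbar}\in\mathbb C^\times$ not be a root of unity, put $q^a=e^{a\hbar}$ for $a\in\mathbb Q$, $q_i=q^{d_i}$, and $[a]=\frac{q^a-q^{-a}}{q-q^{-1}}$. The quantum affine algebra $U_q(\widehat{\mathfrak g})$ (Drinfeld realization) is the associative $\mathbb C$-algebra generated by central invertible $\gamma^{1/2}$, and $d$, $k_i^{\pm1}$, $a_i(n)$ ($0\ne n\in\mathbb Z$), $x_i^\pm(n)$ ($n\in\mathbb Z$), $1\le i\le l$, such that the $k_i$ commute with each other, with $d$ and with all $a_j(n)$, $k_ix_j^\pm(n)k_i^{-1}=q^{\pm(\alpha_i|\alpha_j)}x_j^\pm(n)$, $[d,a_i(n)]=na_i(n)$, $[d,x_i^\pm(n)]=nx_i^\pm(n)$, $$[a_i(m),a_j(n)]=\delta_{m,-n}\frac{[(\alpha_i|\alpha_j)m]}{m}\frac{\gamma^m-\gamma^{-m}}{q-q^{-1}},\qquad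 [a_i(m),x_j^\pm(n)]=\pm\frac{[(\alpha_i|\alpha_j)m]}{m}\gamma^{\mp|m|/2}x_j^\pm(m+n),$$ $$x_i^\pm(m+1)x_j^\pm(n)-q^{\pm(\alpha_i|\alpha_j)}x_i^\pm(m)x_j^\pm(n+1)=q^{\pm(\alpha_i|\alpha_j)}x_j^\pm(n)x_i^\pm(m+1)-x_j^\pm(n+1)x_i^\pm(m),$$ $$[x_i^+(m),x_j^-(n)]=\frac{\delta_{ij}}{q_i-q_i^{-1}}\left(\gamma^{(m-n)/2}\psi_i(m+n)-\gamma^{(n-m)/2}\varphi_i(m+n)\right),$$ where $\sum_{n\ge0}\psi_i(n)z^{-n}=k_i\exp\big((q-q^{-1})\sum_{n>0}a_i(n)z^{-n}\big)$, $\sum_{n\ge0}\varphi_i(-n)z^{n}=k_i^{-1}\exp\big((q^{-1}-q)\sum_{n>0}a_i(-n)z^{n}\big)$, $\psi_i(-n)=\varphi_i(n)=0$ for $n>0$; and, for $i\neq j$, $N=1-A_{ij}$, all $n_1,\dots,n_N,m\in\mathbb Z$, with $q_i$-binomial coefficients, $$\sum_{\sigma\in S_N}\sum_{s=0}^N(-1)^s\begin{bmatrix}N\\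 s\end{bmatrix}_i x_i^\pm(n_{\sigma(1)})\cdots x_i^\pm(n_{\sigma(s)})\,x_j^\pm(m)\,x_i^\pm(n_{\sigma(s+1)})\cdots x_i^\pm(n_{\sigma(N)})=0 .$$ Let $k\in\mathbb Q$, $k\ne0$, and let $V$ be a $U_q(\widehat{\mathfrak g})$-module of level $k$ ($\gamma^{1/2}$ acts as $q^{k/2}$) such that $V=\bigoplus_{a\in\mathbb C}V_a$ with $V_a=\{v: dv=av\}$, all weight spaces (joint eigenspaces of $d$ and the $k_i$) are finite-dimensional, and for each $a\in\mathbb C$ one has $V_{a+n}=0$ for all sufficiently large integers $n$. On any space on which the $a_i(n)$ act, put $$E_-^{\pm}(\pm'\alpha_i,z)=\exp\Big(\mp\sum_{n\ge1}\tfrac{q^{\mp kn/2}}{[kn]}(\pm'a_i(-n))z^n\Big),\qquad E_+^{\pm}(\pm'\alpha_i,z)=\exp\Big(\pm\sum_{n\ge1}\tfrac{q^{\mp kn/2}}{[kn]}(\pm'a_i(n))z^{-n}\Big),$$ where the sign $\pm'$ is independent of $\pm$. Let $x_i^\pm(z)=\sum_{n}x_i^\pm(n)z^{-n-1}$ and,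 on $V$, $Z^\pm(\alpha_i,z)=E_-^\pm(\alpha_i,z)\,x_i^\pm(z)\,E_+^\pm(\alpha_i,z)$. Let $$\Omega_V=\{v\in V: E_+^\pm(\alpha_i,z)v=E_+^\pm(-\alpha_i,z)v=v\ \text{for all } i\text{ and both signs}\}.$$ Let $K(k)$ be the polynomial algebra in the variables $a_i(-n)$ ($1\le i\le l$, $n\ge1$), on which $a_i(-n)$ acts by multiplication and $a_i(n)$ acts as the derivation with $a_j(-m)\mapsto\delta_{m,n}\frac1n[(\alpha_i|\alpha_j)n][nk]$, and let $i:K(k)\to U_q(\widehat{\mathfrak g})$ be the algebra homomorphism with $a_j(-n)\mapsto a_j(-n)$. Then every coefficient of $Z^\pm(\alpha_i,z)$ is well defined on $V$ (applied to a vector, it is a finite sum), and the linear map $$K(k)\otimes_{\mathbb C}\Omega_V\longrightarrow V,\qquad u\otimes w\longmapsto i(u)\cdot w$$ is an isomorphism. Moreover the coefficients of $Z^\pm(\alpha_i,z)$ preserve $\Omega_V$, and under this isomorphism $$x_i^\pm(z)=E_-^\pm(-\alpha_i,z)E_+^\pm(-\alpha_i,z)\otimes Z^\pm(\alpha_i,z)$$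 for all $i$, where the exponentials act on $K(k)$ and $Z^\pm(\alpha_i,z)$ acts on $\Omega_V$ (coefficient by coefficient in $z$, each coefficient applied to a vector being a finite sum). -/

import Mathlib

open scoped TensorProduct

noncomputable section

namespace QAff

/-! ### Simple types, Cartan matrices and the normalized form -/

/-- The types of finite-dimensional simple complex Lie algebras `𝔤`; equivalently the types
`X_l^{(1)}` of the affine Lie algebras of type one. -/
inductive SimpleType : Type
  | A (l : ℕ) (hl : 1 ≤ l)
  | B (l : ℕ) (hl : 2 ≤ l)
  | C (l : ℕ) (hl : 2 ≤ l)
  | D (l : ℕ) (hl : 4 ≤ l)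
  | E6
  | E7
  | E8
  | F4
  | G2

namespace SimpleType

/-- The rank `l` of `𝔤`. -/
abbrev rank : SimpleType → ℕ
  | A l _ => l
  | B l _ => l
  | C l _ => l
  | D l _ => l
  | E6 => 6
  | E7 => 7
  | E8 => 8
  | F4 => 4
  | G2 => 2

/-- The index set of the simple roots. -/
abbrev Idx (X : SimpleType) : Type := Fin X.rank

/-- The Cartan matrix `A i j = ⟨α_i^∨, α_j⟩ = 2 (α_i|α_j) / (α_i|α_i)`. Mathlib's matrices use
the transposed (Bourbaki) convention. -/
def cartan : (X : SimpleType) → Matrix X.Idx X.Idx ℤ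
  | A l _ => (CartanMatrix.A l).transpose
  | B l _ => (CartanMatrix.B l).transpose
  | C l _ => (CartanMatrix.C l).transpose
  | D l _ => (CartanMatrix.D l).transpose
  | E6 => CartanMatrix.E₆.transpose
  | E7 => CartanMatrix.E₇.transpose
  | E8 => CartanMatrix.E₈.transpose
  | F4 => CartanMatrix.F₄.transpose
  | G2 => CartanMatrix.G₂.transpose

/-- `d_i = (α_i|α_i)/2` for the standard normalized invariant form (long roots have square
length `2`). -/
def dd : (X : SimpleType) → X.Idx → ℚ
  | A _ _ => fun _ => 1
  | B l _ => fun i : Fin l => if i.val + 1 = l then 1 / 2 else 1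
  | C l _ => fun i : Fin l => if i.val + 1 = l then 1 else 1 / 2
  | D _ _ => fun _ => 1
  | E6 => fun _ => 1
  | E7 => fun _ => 1
  | E8 => fun _ => 1
  | F4 => fun i : Fin 4 => if i.val < 2 then 1 else 1 / 2
  | G2 => fun i : Fin 2 => if i.val = 0 then 1 else 1 / 3

/-- The values `(α_i|α_j) = d_i A_{ij}` of the normalized invariant form. -/
def form (X : SimpleType) (i j : X.Idx) : ℚ := X.dd i * (X.cartan i j : ℚ)

end SimpleType

/-! ### q-numbers -/

/-- `q^a` for rational `a`, where `q = exp ħ`. -/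
def qpow (ħ : ℂ) (a : ℚ) : ℂ := Complex.exp ((a : ℂ) * ħ)

/-- `[a] = (q^a - q^{-a}) / (q - q^{-1})`. -/
def qnum (ħ : ℂ) (a : ℚ) : ℂ :=
  (qpow ħ a - qpow ħ (-a)) / (qpow ħ 1 - qpow ħ (-1))

/-- `[n]_i = (q_i^n - q_i^{-n}) / (q_i - q_i^{-1})` where `q_i = q^d`, `d = d_i`. -/
def qint (ħ : ℂ) (d : ℚ) (n : ℕ) : ℂ :=
  (qpow ħ (d * n) - qpow ħ (-(d * n))) / (qpow ħ d - qpow ħ (-d))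

/-- `[n]_i! = [1]_i ⋯ [n]_i`. -/
def qfact (ħ : ℂ) (d : ℚ) (n : ℕ) : ℂ := ∏ t ∈ Finset.range n, qint ħ d (t + 1)

/-- The `q_i`-binomial coefficient; only used for `n ≤ m`. -/
def qbinom (ħ : ℂ) (d : ℚ) (m n : ℕ) : ℂ :=
  qfact ħ d m / (qfact ħ d n * qfact ħ d (m - n))

/-! ### Exponentials of formal power series -/

/-- `exp f = ∑_j f^j / j!` for a power series `f` with zero constant term over a (not necessarily
commutative) `ℂ`-algebra: the powers `f^j` with `j > n` do not contribute to degree `n`. -/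
def psExp {R : Type*} [Ring R] [Algebra ℂ R] (f : PowerSeries R) : PowerSeries R :=
  PowerSeries.mk fun n =>
    ∑ j ∈ Finset.range (n + 1), ((j.factorial : ℂ)⁻¹) • PowerSeries.coeff n (f ^ j)

/-- `∑_{n ≥ 1} c(n) b(n) t^n`. -/
def modeSeries {R : Type*} [Ring R] [Algebra ℂ R] (c : ℕ+ → ℂ) (b : ℕ+ → R) : PowerSeries R :=
  PowerSeries.mk fun n => if h : 0 < n then c ⟨n, h⟩ • b ⟨n, h⟩ else 0

/-! ### The quantum affine algebra in Drinfeld's realization -/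

/-- Nonzero integers, the mode numbers of the Heisenberg generators. -/
abbrev NZ : Type := {n : ℤ // n ≠ 0}

/-- The mode number `n`. -/
def NZ.pos (n : ℕ+) : NZ := ⟨((n : ℕ) : ℤ), by exact_mod_cast n.ne_zero⟩

/-- The mode number `-n`. -/
def NZ.neg (n : ℕ+) : NZ := ⟨-((n : ℕ) : ℤ), by simp⟩

/-- Generators: `γ^{1/2}`, `γ^{-1/2}`, `d`, `k_i`, `k_i^{-1}`, `a_i(n)` for `n ≠ 0`, and
`x_i^ε(n)` for `ε = ±1`. -/
inductive Gen (X : SimpleType) : Type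
  | gamma
  | gammaInv
  | deg
  | k (i : X.Idx)
  | kInv (i : X.Idx)
  | a (i : X.Idx) (n : NZ)
  | x (ε : ℤˣ) (i : X.Idx) (n : ℤ)

section Free

variable (X : SimpleType) (ħ : ℂ)

/-- The free algebra on the generators. -/
abbrev Free : Type := FreeAlgebra ℂ (Gen X)

variable {X}

/-- A generator as an element of the free algebra. -/
abbrev gen (g : Gen X) : Free X := FreeAlgebra.ι ℂ g

variable (X)

/-- `γ^{r/2}` for an integer `r`. -/
def gammaHalfPow (r : ℤ) : Free X :=
  if 0 ≤ r then gen Gen.gamma ^ r.toNat else gen Gen.gammaInv ^ (-r).toNat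

variable {X}

/-- `ψ_i(n)`, defined by `∑_{n ≥ 0} ψ_i(n) z^{-n} = k_i exp((q - q⁻¹) ∑_{n > 0} a_i(n) z^{-n})`
and `ψ_i(n) = 0` for `n < 0`. -/
def psi (i : X.Idx) (n : ℤ) : Free X :=
  if 0 ≤ n then
    gen (Gen.k i) * PowerSeries.coeff n.toNat
      (psExp (modeSeries (fun _ => qpow ħ 1 - qpow ħ (-1)) fun m => gen (Gen.a i (NZ.pos m))))
  else 0

/-- `φ_i(n)`, defined by
`∑_{n ≥ 0} φ_i(-n) z^n = k_i⁻¹ exp((q⁻¹ - q) ∑_{n > 0} a_i(-n) z^n)`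
and `φ_i(n) = 0` for `n > 0`. -/
def phi (i : X.Idx) (n : ℤ) : Free X :=
  if n ≤ 0 then
    gen (Gen.kInv i) * PowerSeries.coeff (-n).toNat
      (psExp (modeSeries (fun _ => qpow ħ (-1) - qpow ħ 1) fun m => gen (Gen.a i (NZ.neg m))))
  else 0

/-- The coefficient of `z_1^{-n_1-1} ⋯ z_N^{-n_N-1} w^{-m-1}` in the left-hand side of the
Serre relation, `N = 1 - A i j`:
`Sym ∑_s (-1)^s [N choose s]_i x_i(z_1) ⋯ x_i(z_s) x_j(w) x_i(z_{s+1}) ⋯ x_i(z_N)`. -/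
def serre (ε : ℤˣ) (i j : X.Idx) (N : ℕ) (n : Fin N → ℤ) (m : ℤ) : Free X :=
  ∑ σ : Equiv.Perm (Fin N), ∑ s ∈ Finset.range (N + 1),
    ((-1) ^ s * qbinom ħ (X.dd i) N s) •
      (((List.ofFn fun t => gen (Gen.x ε i (n (σ t)))).take s).prod * gen (Gen.x ε j m) *
        ((List.ofFn fun t => gen (Gen.x ε i (n (σ t)))).drop s).prod)

variable (X)

/-- The defining relations of `U_q(𝔤^)`, in components. -/
inductive Rel : Free X → Free X → Prop
  | gamma_inv : Rel (gen Gen.gamma * gen Gen.gammaInv) 1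
  | inv_gamma : Rel (gen Gen.gammaInv * gen Gen.gamma) 1
  | gamma_central (g : Gen X) : Rel (gen Gen.gamma * gen g) (gen g * gen Gen.gamma)
  | k_inv (i : X.Idx) : Rel (gen (Gen.k i) * gen (Gen.kInv i)) 1
  | inv_k (i : X.Idx) : Rel (gen (Gen.kInv i) * gen (Gen.k i)) 1
  | k_k (i j : X.Idx) : Rel (gen (Gen.k i) * gen (Gen.k j)) (gen (Gen.k j) * gen (Gen.k i))
  | k_deg (i : X.Idx) : Rel (gen (Gen.k i) * gen Gen.deg) (gen Gen.deg * gen (Gen.k i))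
  | k_a (i j : X.Idx) (n : NZ) :
      Rel (gen (Gen.k i) * gen (Gen.a j n)) (gen (Gen.a j n) * gen (Gen.k i))
  | k_x (ε : ℤˣ) (i j : X.Idx) (n : ℤ) :
      Rel (gen (Gen.k i) * gen (Gen.x ε j n))
        (qpow ħ (((ε : ℤ) : ℚ) * X.form i j) • (gen (Gen.x ε j n) * gen (Gen.k i)))
  | deg_a (i : X.Idx) (n : NZ) :
      Rel (gen Gen.deg * gen (Gen.a i n) - gen (Gen.a i n) * gen Gen.deg)
        ((n.1 : ℂ) • gen (Gen.a i n))
  | deg_x (ε : ℤˣ) (i : X.Idx) (n : ℤ) :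
      Rel (gen Gen.deg * gen (Gen.x ε i n) - gen (Gen.x ε i n) * gen Gen.deg)
        ((n : ℂ) • gen (Gen.x ε i n))
  | a_a (i j : X.Idx) (m n : NZ) :
      Rel (gen (Gen.a i m) * gen (Gen.a j n) - gen (Gen.a j n) * gen (Gen.a i m))
        (if m.1 = -n.1 then
          (qnum ħ (X.form i j * m.1) / (m.1 : ℂ) / (qpow ħ 1 - qpow ħ (-1))) •
            (gammaHalfPow X (2 * m.1) - gammaHalfPow X (-(2 * m.1)))
        else 0)
  | a_x (ε : ℤˣ) (i j : X.Idx) (m : NZ) (n : ℤ) :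
      Rel (gen (Gen.a i m) * gen (Gen.x ε j n) - gen (Gen.x ε j n) * gen (Gen.a i m))
        ((((ε : ℤ) : ℂ) * (qnum ħ (X.form i j * m.1) / (m.1 : ℂ))) •
          (gammaHalfPow X (-((ε : ℤ) * |m.1|)) * gen (Gen.x ε j (m.1 + n))))
  | x_x (ε : ℤˣ) (i j : X.Idx) (m n : ℤ) :
      Rel (gen (Gen.x ε i (m + 1)) * gen (Gen.x ε j n)
          - qpow ħ (((ε : ℤ) : ℚ) * X.form i j) •
            (gen (Gen.x ε i m) * gen (Gen.x ε j (n + 1))))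
        (qpow ħ (((ε : ℤ) : ℚ) * X.form i j) •
            (gen (Gen.x ε j n) * gen (Gen.x ε i (m + 1)))
          - gen (Gen.x ε j (n + 1)) * gen (Gen.x ε i m))
  | xp_xm (i j : X.Idx) (m n : ℤ) :
      Rel (gen (Gen.x 1 i m) * gen (Gen.x (-1) j n) - gen (Gen.x (-1) j n) * gen (Gen.x 1 i m))
        (if i = j then
          (qpow ħ (X.dd i) - qpow ħ (-X.dd i))⁻¹ •
            (gammaHalfPow X (m - n) * psi ħ i (m + n) - gammaHalfPow X (n - m) * phi ħ i (m + n))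
        else 0)
  | serre (ε : ℤˣ) (i j : X.Idx) (hij : i ≠ j) (n : Fin (1 - X.cartan i j).toNat → ℤ) (m : ℤ) :
      Rel (serre ħ ε i j (1 - X.cartan i j).toNat n m) 0

/-- The quantum affine algebra `U_q(𝔤^)` with `q = exp ħ`. -/
def Uq : Type := RingQuot (Rel X ħ)

instance : Ring (Uq X ħ) := inferInstanceAs (Ring (RingQuot (Rel X ħ)))

instance : Algebra ℂ (Uq X ħ) := inferInstanceAs (Algebra ℂ (RingQuot (Rel X ħ)))

/-- The quotient map from the free algebra. -/
def Uq.mk : Free X →ₐ[ℂ] Uq X ħ := RingQuot.mkAlgHom ℂ (Rel X ħ)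

variable {X}

/-- A generator as an element of `U_q(𝔤^)`. -/
def Uq.gen (g : Gen X) : Uq X ħ := Uq.mk X ħ (QAff.gen g)

/-- The creation generators `a_i(-n)`, `n ≥ 1`. -/
def Uq.creation (p : X.Idx × ℕ+) : Uq X ħ := Uq.gen ħ (Gen.a p.1 (NZ.neg p.2))

theorem Uq.creation_comm (p p' : X.Idx × ℕ+) :
    Uq.creation ħ p * Uq.creation ħ p' = Uq.creation ħ p' * Uq.creation ħ p := by
  have h := RingQuot.mkAlgHom_rel ℂ (Rel.a_a (ħ := ħ) p.1 p'.1 (NZ.neg p.2) (NZ.neg p'.2))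
  have hne : ¬ ((NZ.neg p.2).1 = -(NZ.neg p'.2).1) := by
    have h1 := p.2.pos
    have h2 := p'.2.pos
    simp only [NZ.neg]
    omega
  rw [if_neg hne, map_zero, map_sub, map_mul, map_mul, sub_eq_zero] at h
  exact h

end Free

/-! ### The Fock module and the embedding of the creation half -/

section Fock

variable (X : SimpleType) (ħ : ℂ)

/-- The space of `K(k)`: the symmetric algebra on the `a_i(-n)`, `n ≥ 1`, i.e. the polynomial
algebra whose variable `(i, n)` is `a_i(-n)`. -/
abbrev Fock : Type := MvPolynomial (X.Idx × ℕ+) ℂ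

variable {X}

/-- `a_i(-n)` acts on `K(k)` by multiplication. -/
def fockCreate (i : X.Idx) (n : ℕ+) : Module.End ℂ (Fock X) :=
  LinearMap.mulLeft ℂ (MvPolynomial.X (i, n))

/-- `a_i(n)` acts on `K(k)` as the derivation with
`a_j(-m) ↦ [a_i(n), a_j(-m)] = δ_{n,m} (1/n) [(α_i|α_j) n] [n k]`. -/
def fockAnnih (k : ℚ) (i : X.Idx) (n : ℕ+) : Module.End ℂ (Fock X) :=
  (MvPolynomial.mkDerivation ℂ fun p : X.Idx × ℕ+ =>
    if p.2 = n then
      MvPolynomial.C (qnum ħ (X.form i p.1 * (n : ℕ)) * qnum ħ ((n : ℕ) * k) / ((n : ℕ) : ℂ))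
    else (0 : Fock X) : Derivation ℂ (Fock X) (Fock X)).toLinearMap

open scoped IsMulCommutative in
/-- The algebra homomorphism `i` from `U_q(𝔥^⁻) = K(k)` to `U_q(𝔤^)` with `a_i(-n) ↦ a_i(-n)`.
It is evaluation of polynomials in the commutative subalgebra generated by the `a_i(-n)`. -/
def incl : Fock X →ₐ[ℂ] Uq X ħ :=
  have := Algebra.isMulCommutative_adjoin ℂ (s := Set.range (Uq.creation (X := X) ħ))
    (by rintro _ ⟨p, rfl⟩ _ ⟨p', rfl⟩; exact Uq.creation_comm ħ p p')
  (Algebra.adjoin ℂ (Set.range (Uq.creation (X := X) ħ))).val.comp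
    (MvPolynomial.aeval fun p =>
      (⟨Uq.creation ħ p, Algebra.subset_adjoin ⟨p, rfl⟩⟩ :
        Algebra.adjoin ℂ (Set.range (Uq.creation (X := X) ħ))))

theorem incl_X (p : X.Idx × ℕ+) : incl ħ (MvPolynomial.X p) = Uq.creation ħ p := by
  simp [incl]

end Fock

/-! ### Exponential operators `E_∓^±(± α_i, z)` -/

section Exponentials

variable (ħ : ℂ) (k : ℚ) {W : Type*} [AddCommGroup W] [Module ℂ W]

/-- `E_-^ε(σ α_i, z) = exp(-ε ∑_{n ≥ 1} (q^{-ε k n / 2} / [k n]) σ a_i(-n) z^n)` on a space with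
creation modes `b n = a_i(-n)`, as a power series in `z`. -/
def Eminus (ε σ : ℤˣ) (b : ℕ+ → Module.End ℂ W) : PowerSeries (Module.End ℂ W) :=
  psExp (modeSeries (fun n =>
    -((ε : ℤ) : ℂ) * (qpow ħ (-(((ε : ℤ) : ℚ) * k * (n : ℕ) / 2)) / qnum ħ (k * (n : ℕ))) *
      ((σ : ℤ) : ℂ)) b)

/-- `E_+^ε(σ α_i, z) = exp(ε ∑_{n ≥ 1} (q^{-ε k n / 2} / [k n]) σ a_i(n) z^{-n})` on a space with
annihilation modes `b n = a_i(n)`, as a power series in `z⁻¹`. -/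
def Eplus (ε σ : ℤˣ) (b : ℕ+ → Module.End ℂ W) : PowerSeries (Module.End ℂ W) :=
  psExp (modeSeries (fun n =>
    ((ε : ℤ) : ℂ) * (qpow ħ (-(((ε : ℤ) : ℚ) * k * (n : ℕ) / 2)) / qnum ħ (k * (n : ℕ))) *
      ((σ : ℤ) : ℂ)) b)

end Exponentials

/-! ### Modules, vacuum space and Z-operators -/

section Modules

variable {X : SimpleType} (ħ : ℂ) (k : ℚ)
variable (V : Type*) [AddCommGroup V] [Module ℂ V] [Module (Uq X ħ) V] [IsScalarTower ℂ (Uq X ħ) V]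

/-- The action of a generator on a `U_q(𝔤^)`-module. -/
def act (g : Gen X) : Module.End ℂ V := Algebra.lsmul ℂ ℂ V (Uq.gen ħ g)

/-- The modes `a_i(-n)` on `V`. -/
def actCreate (i : X.Idx) (n : ℕ+) : Module.End ℂ V := act ħ V (Gen.a i (NZ.neg n))

/-- The modes `a_i(n)` on `V`. -/
def actAnnih (i : X.Idx) (n : ℕ+) : Module.End ℂ V := act ħ V (Gen.a i (NZ.pos n))

/-- The coefficient of `z^m` in `x_i^ε(z) = ∑_n x_i^ε(n) z^{-n-1}`. -/
def xCoeff (ε : ℤˣ) (i : X.Idx) (m : ℤ) : Module.End ℂ V := act ħ V (Gen.x ε i (-m - 1))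

variable (X)

/-- `V_a = {v | d v = a v}`. -/
def degreeSpace (a : ℂ) : Submodule ℂ V := Module.End.eigenspace (act ħ V (Gen.deg (X := X))) a

/-- The weight space of vectors with `d v = a v` and `k_i v = μ_i v` for all `i`. -/
def weightSpace (a : ℂ) (μ : X.Idx → ℂ) : Submodule ℂ V :=
  degreeSpace X ħ V a ⊓ ⨅ i, Module.End.eigenspace (act ħ V (Gen.k i)) (μ i)

/-- The category of level `k` modules: `γ^{1/2}` acts as `q^{k/2}`, `V` is the sum of its
homogeneous subspaces, weight spaces are finite-dimensional and degrees are bounded above in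
every coset of `ℤ`. -/
structure InCategory : Prop where
  level : ∀ v : V, act ħ V (Gen.gamma (X := X)) v = qpow ħ (k / 2) • v
  graded : ⨆ a, degreeSpace X ħ V a = ⊤
  finite : ∀ (a : ℂ) (μ : X.Idx → ℂ), FiniteDimensional ℂ (weightSpace X ħ V a μ)
  bounded : ∀ a : ℂ, ∃ n₀ : ℕ, ∀ n : ℕ, n₀ < n → degreeSpace X ħ V (a + n) = ⊥

/-- The vacuum space: vectors `v` with `E_+^±(α_i, z) v = E_+^±(-α_i, z) v = v` for all `i`,
compared coefficient by coefficient. -/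
def vacuum : Submodule ℂ V where
  carrier := {v | ∀ (ε σ : ℤˣ) (i : X.Idx) (n : ℕ),
    PowerSeries.coeff n (Eplus ħ k ε σ (actAnnih ħ V i)) v = if n = 0 then v else 0}
  add_mem' := by
    intro v w hv hw ε σ i n
    rw [map_add, hv ε σ i n, hw ε σ i n]
    split_ifs <;> simp
  zero_mem' := by
    intro ε σ i n
    simp
  smul_mem' := by
    intro c v hv ε σ i n
    rw [map_smul, hv ε σ i n]
    split_ifs <;> simp

variable {X}

/-- The summand of the coefficient of `z^m` in
`Z^ε(α_i, z) v = E_-^ε(α_i, z) x_i^ε(z) E_+^ε(α_i, z) v` that takes the coefficient of `z^p` in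
`E_-` and that of `z^{-r}` in `E_+`, where `(p, r)` is the last argument. -/
def zTerm (ε : ℤˣ) (i : X.Idx) (m : ℤ) (v : V) (pr : ℕ × ℕ) : V :=
  PowerSeries.coeff pr.1 (Eminus ħ k ε 1 (actCreate ħ V i))
    (xCoeff ħ V ε i (m - pr.1 + pr.2)
      (PowerSeries.coeff pr.2 (Eplus ħ k ε 1 (actAnnih ħ V i)) v))

/-- The coefficient of `z^m` in `Z^ε(α_i, z) v`. -/
def zCoeff (ε : ℤˣ) (i : X.Idx) (m : ℤ) (v : V) : V := ∑ᶠ pr, zTerm ħ k V ε i m v pr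

end Modules

/-- The coefficient of `z^p` in `E_-^ε(-α_i, z)` composed with that of `z^{-r}` in
`E_+^ε(-α_i, z)`, acting on `K(k)`. -/
def fockEE {X : SimpleType} (ħ : ℂ) (k : ℚ) (ε : ℤˣ) (i : X.Idx) (p r : ℕ) :
    Module.End ℂ (Fock X) :=
  PowerSeries.coeff p (Eminus ħ k ε (-1) (fockCreate i)) *
    PowerSeries.coeff r (Eplus ħ k ε (-1) (fockAnnih ħ k i))

end QAff

end

/-! At level `k` the modes form Heisenberg algebras: for each `n ≥ 1` the brackets of the `a_i(n)`
with the `a_j(-n)` form the scalar matrix `[(α_i|α_j)n][nk]/n`. As `q` is not a root of unity and `k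
≠ 0`, the factor `[nk]` is nonzero. The matrix `[(α_i|α_j)n]` is invertible as well (`form_kernel`):
a nonzero kernel vector would make some rational power of `q` a root of unity, which is checked type
by type. Inverting the matrix gives combinations `dualAnnih` of the `a_j(n)` dual to the creation
modes, hence a Weyl algebra in infinitely many variables.

The isomorphism is then an algebraic Stone–von Neumann argument. Degrees are bounded above, so each
dual annihilator is locally nilpotent and all but finitely many of them kill a given vector; the
vacuum space is their common kernel (`mem_vacuum_iff`). Injectivity follows by differentiating a
relation (`fockMap_injective`), surjectivity by stripping off the variables one at a time
(`fockMap_surjective`).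

The constants in `E_±` are chosen so that the bracket of `a_j(n)` with `x_i^±(z)` is cancelled by
its bracket with `E_-` if `n > 0`, and with `E_+` if `n < 0`. Hence `Z^±` commutes with every
Heisenberg mode (`annih_commute_zOp`, `create_commute_zOp`): it preserves the vacuum space and acts
on the second tensor factor only. Multiplying by the inverse exponentials recovers `x_i^±(z)` from
`Z^±` (`finsum_dressTerm_dress`), and moving `Z^±` past the Heisenberg part gives the factorization.
Boundedness of degrees makes every sum finite. -/

noncomputable section

namespace QAff

/-! ### Exponentials of power series with noncommuting coefficients -/

section PsExp

variable {R : Type*} [Ring R]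

theorem coeff_pow_eq_zero_of_lt {f : PowerSeries R} (hf : PowerSeries.coeff 0 f = 0) {n j : ℕ}
    (h : n < j) : PowerSeries.coeff n (f ^ j) = 0 := by
  induction j generalizing n with
  | zero => omega
  | succ j ih =>
    rw [pow_succ, PowerSeries.coeff_mul]
    refine Finset.sum_eq_zero fun p hp => ?_
    rw [Finset.HasAntidiagonal.mem_antidiagonal] at hp
    rcases Nat.lt_or_ge p.1 j with h1 | h1
    · rw [ih h1, zero_mul]
    · rw [show p.2 = 0 by omega, hf, mul_zero]

theorem coeff_mul_congr {f f' g g' : PowerSeries R} {n : ℕ}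
    (hf : ∀ m ≤ n, PowerSeries.coeff m f = PowerSeries.coeff m f')
    (hg : ∀ m ≤ n, PowerSeries.coeff m g = PowerSeries.coeff m g') :
    PowerSeries.coeff n (f * g) = PowerSeries.coeff n (f' * g') := by
  rw [PowerSeries.coeff_mul, PowerSeries.coeff_mul]
  refine Finset.sum_congr rfl fun p hp => ?_
  rw [Finset.HasAntidiagonal.mem_antidiagonal] at hp
  rw [hf _ (by omega), hg _ (by omega)]

variable [Algebra ℂ R]

/-- The truncated exponential `∑_{j < N} f^j / j!`. -/
def expPartial (N : ℕ) (f : PowerSeries R) : PowerSeries R :=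
  ∑ j ∈ Finset.range N, ((j.factorial : ℂ)⁻¹) • f ^ j

theorem coeff_psExp_eq_expPartial {f : PowerSeries R} (hf : PowerSeries.coeff 0 f = 0) {n N : ℕ}
    (h : n < N) : PowerSeries.coeff n (psExp f) = PowerSeries.coeff n (expPartial N f) := by
  rw [psExp, PowerSeries.coeff_mk, expPartial, map_sum]
  refine (Finset.sum_subset (Finset.range_subset_range.2 h) fun j _ hj => ?_).trans
    (Finset.sum_congr rfl fun j _ => ?_)
  · rw [Finset.mem_range, not_lt] at hj
    rw [coeff_pow_eq_zero_of_lt hf (by omega), smul_zero]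
  · rfl

theorem expPartial_eq_aeval (N : ℕ) (f : PowerSeries R) :
    expPartial N f = Polynomial.aeval f (PowerSeries.trunc N (PowerSeries.exp ℂ)) := by
  rw [expPartial, Polynomial.aeval_def, PowerSeries.eval₂_trunc_eq_sum_range]
  refine Finset.sum_congr rfl fun j _ => ?_
  rw [PowerSeries.coeff_exp, Algebra.smul_def]
  simp

theorem expPartial_neg_eq_aeval (N : ℕ) (f : PowerSeries R) :
    expPartial N (-f) = Polynomial.aeval f
      (PowerSeries.trunc N (PowerSeries.evalNegHom (PowerSeries.exp ℂ))) := by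
  rw [expPartial, Polynomial.aeval_def, PowerSeries.eval₂_trunc_eq_sum_range]
  refine Finset.sum_congr rfl fun j _ => ?_
  rw [PowerSeries.evalNegHom, PowerSeries.coeff_rescale, PowerSeries.coeff_exp, neg_pow]
  simp [Algebra.smul_def, mul_assoc]
  rw [← mul_assoc, ← mul_assoc]
  congr 1
  exact ((Commute.one_left _).neg_left.pow_left _).eq.symm

/-- Only powers of the single series `f` occur, so polynomials evaluated at `f` suffice. The
truncations of `exp X` and `exp (-X)` multiply to `1` modulo `X ^ (n + 1)`, and multiples of `f ^ (n
+ 1)` have no coefficient in degree `n`. -/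
theorem psExp_mul_psExp_neg {f : PowerSeries R} (hf : PowerSeries.coeff 0 f = 0) :
    psExp f * psExp (-f) = 1 := by
  ext n
  have hf' : PowerSeries.coeff 0 (-f) = 0 := by rw [map_neg, hf, neg_zero]
  rw [coeff_mul_congr (f' := expPartial (n + 1) f) (g' := expPartial (n + 1) (-f))
    (fun m hm => coeff_psExp_eq_expPartial hf (by omega))
    (fun m hm => coeff_psExp_eq_expPartial hf' (by omega)),
    expPartial_eq_aeval, expPartial_neg_eq_aeval, ← map_mul]
  set P := PowerSeries.trunc (n + 1) (PowerSeries.exp ℂ)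
  set Q := PowerSeries.trunc (n + 1) (PowerSeries.evalNegHom (PowerSeries.exp ℂ))
  obtain ⟨T, hT⟩ : Polynomial.X ^ (n + 1) ∣ P * Q - 1 := by
    rw [Polynomial.X_pow_dvd_iff]
    intro d hd
    have h := PowerSeries.coeff_mul_eq_coeff_trunc_mul_trunc (PowerSeries.exp ℂ)
      (PowerSeries.evalNegHom (PowerSeries.exp ℂ)) hd
    rw [PowerSeries.exp_mul_exp_neg_eq_one] at h
    rw [Polynomial.coeff_sub, sub_eq_zero]
    rw [← Polynomial.coe_mul, Polynomial.coeff_coe] at h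
    rw [← h, PowerSeries.coeff_one, Polynomial.coeff_one]
  rw [sub_eq_iff_eq_add.1 hT, map_add, map_one, map_mul, map_pow, Polynomial.aeval_X, map_add]
  have : PowerSeries.coeff n (f ^ (n + 1) * Polynomial.aeval f T) = 0 := by
    rw [PowerSeries.coeff_mul]
    refine Finset.sum_eq_zero fun p hp => ?_
    rw [Finset.HasAntidiagonal.mem_antidiagonal] at hp
    rw [coeff_pow_eq_zero_of_lt hf (by omega), zero_mul]
  rw [this, zero_add]

theorem psExp_neg_mul_psExp {f : PowerSeries R} (hf : PowerSeries.coeff 0 f = 0) :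
    psExp (-f) * psExp f = 1 := by
  have := psExp_mul_psExp_neg (f := -f) (by rw [map_neg, hf, neg_zero])
  rwa [neg_neg] at this

theorem commutator_pow {S : Type*} [Ring S] {a f g : S} (h : a * f - f * a = g)
    (hg : Commute g f) (j : ℕ) : a * f ^ (j + 1) - f ^ (j + 1) * a = (j + 1) • (g * f ^ j) := by
  induction j with
  | zero => simpa using h
  | succ j ih =>
    have : a * f ^ (j + 1 + 1) - f ^ (j + 1 + 1) * a =
        (a * f ^ (j + 1) - f ^ (j + 1) * a) * f + f ^ (j + 1) * (a * f - f * a) := by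
      rw [pow_succ f (j + 1)]
      noncomm_ring
    rw [this, ih, h, ← (hg.pow_right (j + 1)).eq, succ_nsmul _ (j + 1), smul_mul_assoc, mul_assoc,
      ← pow_succ]

theorem commutator_expPartial {a f g : PowerSeries R} (h : a * f - f * a = g)
    (hg : Commute g f) (N : ℕ) :
    a * expPartial (N + 1) f - expPartial (N + 1) f * a = g * expPartial N f := by
  rw [expPartial, expPartial, Finset.mul_sum, Finset.sum_mul, ← Finset.sum_sub_distrib,
    Finset.sum_range_succ', Finset.mul_sum]
  simp only [pow_zero, mul_smul_comm, smul_mul_assoc, mul_one, one_mul, sub_self, add_zero,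
    ← smul_sub]
  refine Finset.sum_congr rfl fun j _ => ?_
  rw [commutator_pow h hg, ← Nat.cast_smul_eq_nsmul ℂ, smul_smul, Nat.factorial_succ]
  congr 1
  have : ((j : ℂ) + 1) ≠ 0 := by exact_mod_cast j.succ_ne_zero
  push_cast
  field_simp

/-- If `[a, f] = g` commutes with `f`, then `[a, exp f] = g exp f`. -/
theorem commutator_psExp {a f g : PowerSeries R} (hf : PowerSeries.coeff 0 f = 0)
    (h : a * f - f * a = g) (hg : Commute g f) :
    a * psExp f - psExp f * a = g * psExp f := by
  ext n
  -- Bracketing with `a` shortens the truncated exponential by one term, so two truncation lengths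
  -- are needed.
  have h1 : ∀ m ≤ n, PowerSeries.coeff m (psExp f) = PowerSeries.coeff m (expPartial (n + 2) f) :=
    fun m hm => coeff_psExp_eq_expPartial hf (by omega)
  have h2 : ∀ m ≤ n, PowerSeries.coeff m (psExp f) = PowerSeries.coeff m (expPartial (n + 1) f) :=
    fun m hm => coeff_psExp_eq_expPartial hf (by omega)
  rw [map_sub, coeff_mul_congr (fun _ _ => rfl) h1, coeff_mul_congr h1 (fun _ _ => rfl),
    coeff_mul_congr (f := g) (fun _ _ => rfl) h2, ← map_sub, commutator_expPartial h hg]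

@[simp]
theorem coeff_zero_modeSeries (c : ℕ+ → ℂ) (b : ℕ+ → R) :
    PowerSeries.coeff 0 (modeSeries c b) = 0 := by
  simp [modeSeries]

theorem coeff_modeSeries (c : ℕ+ → ℂ) (b : ℕ+ → R) (n : ℕ+) :
    PowerSeries.coeff (n : ℕ) (modeSeries c b) = c n • b n := by
  rw [modeSeries, PowerSeries.coeff_mk, dif_pos n.pos]
  rfl

theorem modeSeries_neg (c : ℕ+ → ℂ) (b : ℕ+ → R) :
    modeSeries (fun n => -c n) b = -modeSeries c b := by
  ext n
  simp only [modeSeries, PowerSeries.coeff_mk, map_neg]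
  split_ifs <;> simp

/-- The commutator of `a` with `exp(∑ c(m) b(m) t^m)`, when `a` commutes with all `b(m)` but
`b(n)`, and `[a, b(n)] = s`. -/
theorem commutator_coeff_psExp (c : ℕ+ → ℂ) (b : ℕ+ → R) (a : R) (n : ℕ+) (s : ℂ)
    (h : ∀ m, a * b m - b m * a = if m = n then s • (1 : R) else 0) (p : ℕ) :
    a * PowerSeries.coeff p (psExp (modeSeries c b)) -
      PowerSeries.coeff p (psExp (modeSeries c b)) * a =
    if (n : ℕ) ≤ p then (c n * s) • PowerSeries.coeff (p - n) (psExp (modeSeries c b)) else 0 := by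
  have h1 : PowerSeries.C a * modeSeries c b - modeSeries c b * PowerSeries.C a =
      (c n * s) • PowerSeries.X ^ (n : ℕ) := by
    ext m
    rw [map_sub, PowerSeries.coeff_C_mul, PowerSeries.coeff_mul_C, PowerSeries.coeff_smul,
      PowerSeries.coeff_X_pow]
    rcases Nat.eq_zero_or_pos m with rfl | hm
    · rw [coeff_zero_modeSeries, if_neg n.pos.ne]
      simp
    · lift m to ℕ+ using hm
      rw [coeff_modeSeries, mul_smul_comm, smul_mul_assoc, ← smul_sub, h]
      simp only [PNat.coe_inj]
      split_ifs with hmn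
      · rw [hmn, smul_smul]
      · simp
  have h2 : Commute ((c n * s) • (PowerSeries.X : PowerSeries R) ^ (n : ℕ)) (modeSeries c b) :=
    (((PowerSeries.commute_X _).symm.pow_left _)).smul_left _
  have h3 := congrArg (PowerSeries.coeff p) (commutator_psExp (coeff_zero_modeSeries c b) h1 h2)
  rw [map_sub, PowerSeries.coeff_C_mul, PowerSeries.coeff_mul_C] at h3
  rw [h3, smul_mul_assoc, PowerSeries.coeff_smul, PowerSeries.coeff_X_pow_mul']
  split_ifs <;> simp

theorem commute_coeff_psExp (c : ℕ+ → ℂ) (b : ℕ+ → R) (a : R) (h : ∀ m, Commute a (b m)) (p : ℕ) :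
    Commute a (PowerSeries.coeff p (psExp (modeSeries c b))) := by
  have := commutator_coeff_psExp c b a 1 0 (fun m => by simp [(h m).eq]) p
  rw [mul_zero, zero_smul, ite_self, sub_eq_zero] at this
  exact this

end PsExp

/-! ### Exponentials of modes acting on vectors -/

section Operators

variable {V W : Type*} [AddCommGroup V] [Module ℂ V] [AddCommGroup W] [Module ℂ W]

theorem coeff_pow_intertwine {F : PowerSeries (Module.End ℂ W)} {G : PowerSeries (Module.End ℂ V)}
    {T : W →ₗ[ℂ] V} (h : ∀ n w, T (PowerSeries.coeff n F w) = PowerSeries.coeff n G (T w))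
    (j n : ℕ) (w : W) :
    T (PowerSeries.coeff n (F ^ j) w) = PowerSeries.coeff n (G ^ j) (T w) := by
  induction j generalizing n w with
  | zero =>
    simp only [pow_zero, PowerSeries.coeff_one]
    split_ifs <;> simp
  | succ j ih =>
    simp only [pow_succ, PowerSeries.coeff_mul, LinearMap.sum_apply, map_sum, Module.End.mul_apply,
      ih, h]

/-- Linear maps that intertwine modes intertwine the exponentials of their generating series. -/
theorem coeff_psExp_intertwine (c : ℕ+ → ℂ) {b : ℕ+ → Module.End ℂ W} {b' : ℕ+ → Module.End ℂ V}
    {T : W →ₗ[ℂ] V} (h : ∀ n w, T (b n w) = b' n (T w)) (n : ℕ) (w : W) :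
    T (PowerSeries.coeff n (psExp (modeSeries c b)) w) =
      PowerSeries.coeff n (psExp (modeSeries c b')) (T w) := by
  have h' : ∀ n w, T (PowerSeries.coeff n (modeSeries c b) w) =
      PowerSeries.coeff n (modeSeries c b') (T w) := by
    intro n w
    rcases Nat.eq_zero_or_pos n with rfl | hn
    · simp
    · lift n to ℕ+ using hn
      simp [coeff_modeSeries, h]
  simp only [psExp, PowerSeries.coeff_mk, LinearMap.sum_apply, map_sum, LinearMap.smul_apply,
    map_smul, coeff_pow_intertwine h']

theorem coeff_psExp_apply_of_annihilated (c : ℕ+ → ℂ) {b : ℕ+ → Module.End ℂ V} {v : V}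
    (h : ∀ n, b n v = 0) (n : ℕ) :
    PowerSeries.coeff n (psExp (modeSeries c b)) v = if n = 0 then v else 0 := by
  -- Compare with `ℂ` carrying zero modes, along `1 ↦ v`; there the exponential is `1`.
  have h1 := coeff_psExp_intertwine c (b := fun _ => (0 : Module.End ℂ ℂ)) (b' := b)
    (T := LinearMap.toSpanSingleton ℂ V v) (fun n w => by simp [h]) n 1
  rw [LinearMap.toSpanSingleton_apply_one] at h1
  rw [← h1]
  have h0 : modeSeries c (fun _ => (0 : Module.End ℂ ℂ)) = 0 := by
    ext n
    simp [modeSeries]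
  have : PowerSeries.coeff n (psExp (0 : PowerSeries (Module.End ℂ ℂ))) =
      if n = 0 then 1 else 0 := by
    rw [psExp, PowerSeries.coeff_mk, Finset.sum_eq_single 0]
    · simp [PowerSeries.coeff_one]
    · intro j _ hj
      simp [hj]
    · simp
  rw [h0, this]
  split_ifs <;> simp

/-- Induction on the degree: once the lower modes kill `v`, only the linear term of the exponential
survives in degree `n`. In a higher power either the rightmost factor has degree below `n` and kills
`v`, or the remaining factors have total degree `0` and vanish. -/
theorem annihilated_of_coeff_psExp_apply {c : ℕ+ → ℂ} (hc : ∀ n, c n ≠ 0)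
    {b : ℕ+ → Module.End ℂ V} {v : V}
    (h : ∀ n, PowerSeries.coeff n (psExp (modeSeries c b)) v = if n = 0 then v else 0) (n : ℕ+) :
    b n v = 0 := by
  suffices H : ∀ n : ℕ, PowerSeries.coeff n (modeSeries c b) v = 0 by
    have := H n
    rw [coeff_modeSeries, LinearMap.smul_apply, smul_eq_zero] at this
    exact this.resolve_left (hc n)
  intro n
  induction n using Nat.strong_induction_on with
  | _ n ih =>
    rcases Nat.eq_zero_or_pos n with rfl | hn
    · simp
    have h1 := h n
    rw [if_neg hn.ne', psExp, PowerSeries.coeff_mk, LinearMap.sum_apply,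
      Finset.sum_eq_single 1] at h1
    · simpa using h1
    · intro j _ hj
      rw [LinearMap.smul_apply]
      rcases j with _ | _ | j
      · simp [PowerSeries.coeff_one, hn.ne']
      · exact absurd rfl hj
      · rw [pow_succ, PowerSeries.coeff_mul, LinearMap.sum_apply, Finset.sum_eq_zero, smul_zero]
        intro p hp
        rw [Finset.HasAntidiagonal.mem_antidiagonal] at hp
        rw [Module.End.mul_apply]
        rcases Nat.lt_or_ge p.2 n with h2 | h2
        · rw [ih _ h2, map_zero]
        · rw [coeff_pow_eq_zero_of_lt (coeff_zero_modeSeries c b) (by omega),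
            LinearMap.zero_apply]
    · intro h2
      exact absurd (Finset.mem_range.2 (by omega)) h2

end Operators

/-! ### q-numbers when `q` is not a root of unity -/

section QNumbers

variable (ħ : ℂ)

theorem qpow_ne_zero (a : ℚ) : qpow ħ a ≠ 0 := Complex.exp_ne_zero _

theorem qpow_neg (a : ℚ) : qpow ħ (-a) = (qpow ħ a)⁻¹ := by
  rw [qpow, qpow, ← Complex.exp_neg]
  push_cast
  ring_nf

theorem qpow_nat_mul (n : ℕ) (a : ℚ) : qpow ħ (n * a) = qpow ħ a ^ n := by
  rw [qpow, qpow, ← Complex.exp_nat_mul]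
  push_cast
  ring_nf

@[simp]
theorem qnum_zero : qnum ħ 0 = 0 := by simp [qnum]

theorem qnum_neg (a : ℚ) : qnum ħ (-a) = -qnum ħ a := by
  rw [qnum, qnum, neg_neg]
  ring

theorem qnum_two_mul (a : ℚ) : qnum ħ (2 * a) = (qpow ħ a + (qpow ħ a)⁻¹) * qnum ħ a := by
  have h := qpow_nat_mul ħ 2 a
  push_cast at h
  rw [qnum, qnum, qpow_neg ħ (2 * a), h, qpow_neg ħ a]
  ring

variable {ħ} (hq : ∀ n : ℕ, 0 < n → Complex.exp ħ ^ n ≠ 1)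
include hq

/-- Raising `q^a = 1` to the denominator of `a` gives a nonzero integral power of `q` equal to `1`.
-/
theorem qpow_ne_one {a : ℚ} (ha : a ≠ 0) : qpow ħ a ≠ 1 := by
  intro h
  have h1 : qpow ħ (a.num : ℚ) = 1 := by
    have := qpow_nat_mul ħ a.den a
    rwa [h, one_pow, mul_comm, Rat.mul_den_eq_num] at this
  obtain ⟨N, hN⟩ := Int.eq_nat_or_neg a.num
  have hN0 : 0 < N := by
    have := Rat.num_ne_zero.2 ha
    omega
  have h2 : qpow ħ (N : ℚ) = 1 := by
    rcases hN with h3 | h3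
    · rw [h3] at h1
      exact_mod_cast h1
    · rw [h3] at h1
      push_cast at h1
      rwa [qpow_neg, inv_eq_one] at h1
  refine hq N hN0 ?_
  rw [← Complex.exp_nat_mul]
  simpa [qpow] using h2

theorem qpow_pow_ne_one {a : ℚ} (ha : a ≠ 0) {n : ℕ} (hn : 0 < n) : qpow ħ a ^ n ≠ 1 := by
  rw [← qpow_nat_mul]
  exact qpow_ne_one hq (mul_ne_zero (by exact_mod_cast hn.ne') ha)

theorem qpow_sub_qpow_neg_ne_zero {a : ℚ} (ha : a ≠ 0) : qpow ħ a - qpow ħ (-a) ≠ 0 := by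
  intro h
  rw [qpow_neg, sub_eq_zero] at h
  refine qpow_pow_ne_one hq ha (n := 2) (by norm_num) ?_
  rw [pow_two]
  nth_rewrite 2 [h]
  exact mul_inv_cancel₀ (qpow_ne_zero ħ a)

theorem qnum_ne_zero {a : ℚ} (ha : a ≠ 0) : qnum ħ a ≠ 0 :=
  div_ne_zero (qpow_sub_qpow_neg_ne_zero hq ha) (qpow_sub_qpow_neg_ne_zero hq one_ne_zero)

end QNumbers

/-! ### Nondegeneracy of the q-deformed Cartan matrix, type by type -/

section Chain

/-- Nonzero and not a root of unity. -/
structure Generic (y : ℂ) : Prop where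
  ne_zero : y ≠ 0
  pow_ne_one : ∀ n, 0 < n → y ^ n ≠ 1

namespace Generic

variable {y : ℂ} (hy : Generic y)
include hy

theorem pow_ne_neg_one {n : ℕ} (hn : 0 < n) : y ^ n ≠ -1 := by
  intro h
  refine hy.pow_ne_one (n * 2) (by omega) ?_
  rw [pow_mul, h]
  norm_num

theorem sub_ne_zero {n : ℕ} (hn : 0 < n) : y ^ n - y⁻¹ ^ n ≠ 0 := by
  intro h
  refine hy.pow_ne_one (n + n) (by omega) ?_
  rw [pow_add]
  nth_rewrite 2 [_root_.sub_eq_zero.1 h]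
  rw [← mul_pow, mul_inv_cancel₀ hy.ne_zero, one_pow]

theorem add_ne_zero : y + y⁻¹ ≠ 0 := by
  intro h
  refine hy.pow_ne_neg_one (n := 2) (by norm_num) ?_
  have := hy.ne_zero
  field_simp at h
  linear_combination h

/-- Multiplied by `y ^ 2` this is `y ^ 4 + y ^ 2 + 1`, a divisor of `y ^ 6 - 1`. -/
theorem add_sq_sub_one_ne_zero : (y + y⁻¹) ^ 2 - 1 ≠ 0 := by
  intro h
  refine hy.pow_ne_one 6 (by norm_num) ?_
  have := hy.ne_zero
  field_simp at h
  linear_combination (y ^ 2 - 1) * h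

/-- Solutions of `(y + y⁻¹) w_i = w_{i-1} + w_{i+1}` with `w_{-1} = 0`. -/
theorem chain_solution {w : ℕ → ℂ} {N : ℕ}
    (h : ∀ i, i < N → (y + y⁻¹) * w i = (if i = 0 then 0 else w (i - 1)) + w (i + 1))
    {i : ℕ} (hi : i ≤ N) :
    (y - y⁻¹) * w i = (y ^ (i + 1) - y⁻¹ ^ (i + 1)) * w 0 := by
  have hyy := mul_inv_cancel₀ hy.ne_zero
  induction i using Nat.twoStepInduction with
  | zero => ring
  | one =>
    have := h 0 (by omega)
    simp only [if_true, zero_add] at this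
    rw [← this]
    ring
  | more i ih ih' =>
    have h1 := h (i + 1) (by omega)
    simp only [Nat.add_eq_zero_iff, one_ne_zero, and_false, if_false, Nat.add_sub_cancel] at h1
    have h2 := ih (by omega)
    have h3 := ih' (by omega)
    linear_combination (y - y⁻¹) * -h1 + (y + y⁻¹) * h3 - h2 +
      (y ^ (i + 1) - y⁻¹ ^ (i + 1)) * w 0 * hyy

theorem chain_eq_zero {w : ℕ → ℂ} {N : ℕ}
    (h : ∀ i, i < N → (y + y⁻¹) * w i = (if i = 0 then 0 else w (i - 1)) + w (i + 1))
    (h0 : w 0 = 0) {i : ℕ} (hi : i ≤ N) : w i = 0 := by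
  have h1 := hy.chain_solution h hi
  rw [h0, mul_zero, mul_eq_zero] at h1
  refine h1.resolve_left ?_
  simpa using hy.sub_ne_zero one_pos

end Generic

/-- Adding the vanishing term `f l` lets the last row keep the three-term shape. The `if` suppresses
the left neighbour at `i = 0`, where truncated subtraction would count `f 0` twice. -/
theorem sum_range_tridiagonal {f : ℕ → ℂ} {l i : ℕ} (hi : i < l) (hl : f l = 0)
    (hf : ∀ j, j ≠ i → j + 1 ≠ i → i + 1 ≠ j → f j = 0) :
    ∑ j ∈ Finset.range l, f j = (if i = 0 then 0 else f (i - 1)) + f i + f (i + 1) := by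
  have hsum : ∑ j ∈ Finset.range l, f j = ∑ j ∈ Finset.range (l + 1), f j := by
    rw [Finset.sum_range_succ, hl, add_zero]
  rw [hsum]
  rcases i with _ | i
  · rw [← Finset.sum_subset (s₁ := {0, 1})]
    · simp
    · intro j hj
      simp only [Finset.mem_insert, Finset.mem_singleton, Finset.mem_range] at hj ⊢
      omega
    · intro j _ hj
      simp only [Finset.mem_insert, Finset.mem_singleton, not_or] at hj
      exact hf j hj.1 (by omega) (by omega)
  · rw [← Finset.sum_subset (s₁ := {i, i + 1, i + 2})]
    · rw [Finset.sum_insert (by simp), Finset.sum_pair (by simp)]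
      simp [add_assoc]
    · intro j hj
      simp only [Finset.mem_insert, Finset.mem_singleton, Finset.mem_range] at hj ⊢
      omega
    · intro j _ hj
      simp only [Finset.mem_insert, Finset.mem_singleton, not_or] at hj
      exact hf j (by omega) (by omega) (by omega)

/-- Extension of a vector by zero. -/
def extendZero {l : ℕ} (v : Fin l → ℂ) (n : ℕ) : ℂ := if h : n < l then v ⟨n, h⟩ else 0

theorem extendZero_val {l : ℕ} (v : Fin l → ℂ) (i : Fin l) : extendZero v i = v i := by
  simp [extendZero]

theorem extendZero_self {l : ℕ} (v : Fin l → ℂ) : extendZero v l = 0 := by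
  simp [extendZero]

theorem eq_zero_of_extendZero {l : ℕ} {v : Fin l → ℂ} (h : ∀ n < l, extendZero v n = 0) :
    v = 0 := by
  ext i
  rw [← extendZero_val v, h i i.2, Pi.zero_apply]

theorem sum_fin_eq_sum_range_extendZero {l : ℕ} (v : Fin l → ℂ) (g : ℕ → ℂ) {G : Fin l → ℂ}
    (h : ∀ j, G j = g j) :
    ∑ j, G j * v j = ∑ j ∈ Finset.range l, g j * extendZero v j := by
  rw [Finset.sum_range]
  exact Finset.sum_congr rfl fun j _ => by rw [h, extendZero_val]

end Chain

section Nondegenerate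

variable {ħ : ℂ} (hq : ∀ n : ℕ, 0 < n → Complex.exp ħ ^ n ≠ 1) {t : ℚ} (ht : t ≠ 0)
include hq ht

theorem generic_qpow : Generic (qpow ħ t) :=
  ⟨qpow_ne_zero ħ t, fun _ hn => qpow_pow_ne_one hq ht hn⟩

/-- The coordinates form a chain that is zero just beyond both ends, and its value at `l` is
proportional to `(y ^ (l + 1) - y⁻¹ ^ (l + 1)) * w 0`. -/
theorem kernel_A {l : ℕ} (hl : 1 ≤ l) {v : Fin l → ℂ}
    (h : ∀ i : Fin l, ∑ j : Fin l, qnum ħ ((SimpleType.A l hl).form i j * t) * v j = 0) :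
    v = 0 := by
  have hy := generic_qpow hq ht
  set y := qpow ħ t
  set w := extendZero v
  have hs := qnum_ne_zero hq ht
  have hrow : ∀ i, i < l → (y + y⁻¹) * w i = (if i = 0 then 0 else w (i - 1)) + w (i + 1) := by
    intro i hi
    have h1 := h ⟨i, hi⟩
    rw [sum_fin_eq_sum_range_extendZero v
      (fun j => qnum ħ ((if i = j then 2 else if i + 1 = j ∨ j + 1 = i then -1 else 0) * t)),
      sum_range_tridiagonal hi] at h1
    · apply mul_left_cancel₀ hs
      rcases i with _ | i
      · simp [qnum_two_mul, qnum_neg] at h1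
        rw [if_pos rfl]
        linear_combination h1
      · simp [qnum_two_mul, qnum_neg] at h1
        rw [if_neg i.succ_ne_zero, Nat.add_sub_cancel]
        linear_combination h1
    · rw [extendZero_self, mul_zero]
    · intro j h2 h3 h4
      simp [h2.symm, h3, h4]
    · intro j
      simp only [SimpleType.form, SimpleType.cartan, SimpleType.dd, CartanMatrix.A_transpose]
      simp only [CartanMatrix.A, Matrix.of_apply, Fin.ext_iff, one_mul]
      push_cast
      rfl
  have h0 : w 0 = 0 := by
    have h1 := hy.chain_solution hrow le_rfl
    rw [show w l = 0 from extendZero_self v, mul_zero, eq_comm, mul_eq_zero] at h1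
    exact h1.resolve_left (hy.sub_ne_zero (by omega))
  exact eq_zero_of_extendZero fun n hn => hy.chain_eq_zero hrow h0 hn.le

end Nondegenerate

section Nondegenerate

variable {ħ : ℂ} (hq : ∀ n : ℕ, 0 < n → Complex.exp ħ ^ n ≠ 1) {t : ℚ} (ht : t ≠ 0)
include hq ht

/-- The row of the short root makes the last two coordinates equal. Inserted into the chain
solution, this would force `(y - 1) * (y ^ (2 * l - 1) + 1) = 0` unless `w 0 = 0`. -/
theorem kernel_B {l : ℕ} (hl : 2 ≤ l) {v : Fin l → ℂ}
    (h : ∀ i : Fin l, ∑ j : Fin l, qnum ħ ((SimpleType.B l hl).form i j * t) * v j = 0) :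
    v = 0 := by
  have hy := generic_qpow hq ht
  set y := qpow ħ t
  have hs := qnum_ne_zero hq ht
  obtain ⟨n, rfl⟩ : ∃ n, l = n + 2 := ⟨l - 2, by omega⟩
  set w := extendZero v
  have hw : w (n + 2) = 0 := extendZero_self v
  let g : ℕ → ℕ → ℚ := fun i j => (if i + 1 = n + 2 then 1 / 2 else 1) *
    (if i = j then 2 else if i + 1 = j then -1
      else if j + 1 = i then (if i = n + 2 - 1 then -2 else -1) else 0)
  have hsum : ∀ i, i < n + 2 → ∑ j ∈ Finset.range (n + 2), qnum ħ (g i j * t) * w j = 0 := by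
    intro i hi
    rw [← h ⟨i, hi⟩]
    symm
    refine sum_fin_eq_sum_range_extendZero v (fun j => qnum ħ _) fun j => ?_
    simp only [SimpleType.form, SimpleType.cartan, SimpleType.dd, CartanMatrix.B_transpose]
    simp only [CartanMatrix.C, Matrix.of_apply, Fin.ext_iff, g]
    push_cast
    rfl
  have hfar : ∀ i j, j ≠ i → j + 1 ≠ i → i + 1 ≠ j → qnum ħ (g i j * t) * w j = 0 := by
    intro i j h2 h3 h4
    simp [g, h2.symm, h3, h4]
  have g2 : ∀ {i j}, g i j = 2 → qnum ħ (g i j * t) = (y + y⁻¹) * qnum ħ t := by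
    intro i j hij
    rw [hij, qnum_two_mul]
  have g1 : ∀ {i j}, g i j = -1 → qnum ħ (g i j * t) = -qnum ħ t := by
    intro i j hij
    rw [hij, neg_one_mul, qnum_neg]
  have hrow : ∀ i, i < n + 1 →
      (y + y⁻¹) * w i = (if i = 0 then 0 else w (i - 1)) + w (i + 1) := by
    intro i hi
    have h1 := hsum i (by omega)
    rw [sum_range_tridiagonal (i := i) (by omega) (by rw [hw, mul_zero]) (hfar i),
      g2 (i := i) (j := i) (by simp only [g]; grind),
      g1 (i := i) (j := i + 1) (by simp only [g]; grind)] at h1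
    apply mul_left_cancel₀ hs
    rcases i with _ | i
    · rw [if_pos rfl] at h1 ⊢
      linear_combination h1
    · rw [if_neg i.succ_ne_zero, Nat.add_sub_cancel,
        g1 (i := i + 1) (j := i) (by simp only [g]; grind)] at h1
      rw [if_neg i.succ_ne_zero, Nat.add_sub_cancel]
      linear_combination h1
  have hlast : w (n + 1) = w n := by
    have h1 := hsum (n + 1) (by omega)
    rw [sum_range_tridiagonal (i := n + 1) (by omega) (by rw [hw, mul_zero]) (hfar _), hw,
      if_neg n.succ_ne_zero, Nat.add_sub_cancel, g1 (by simp only [g]; grind),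
      show g (n + 1) (n + 1) = 1 by simp [g], one_mul] at h1
    apply mul_left_cancel₀ hs
    linear_combination h1
  have h0 : w 0 = 0 := by
    have h1 := hy.chain_solution hrow (i := n + 1) le_rfl
    have h2 := hy.chain_solution hrow (i := n) (by omega)
    rw [hlast, h2, ← sub_eq_zero, ← sub_mul, mul_eq_zero] at h1
    refine h1.resolve_left fun h3 => ?_
    have h4 : (y - 1) * (y ^ (2 * n + 3) + 1) = 0 := by
      have hyy : ∀ m, y ^ m * y⁻¹ ^ m = 1 := fun m => by
        rw [← mul_pow, mul_inv_cancel₀ hy.ne_zero, one_pow]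
      linear_combination (-y ^ (n + 2)) * h3 + hyy (n + 2) - y * hyy (n + 1)
    rcases mul_eq_zero.1 h4 with h5 | h5
    · exact hy.pow_ne_one 1 one_pos (by linear_combination h5)
    · exact hy.pow_ne_neg_one (n := 2 * n + 3) (by omega) (by linear_combination h5)
  exact eq_zero_of_extendZero fun m hm => hy.chain_eq_zero hrow h0 (by omega)

/-- Off-diagonal values of the form can be `-1/2`, hence the parameter `y = q^(t/2)`. Rescaled by `y
+ y⁻¹`, the last coordinate prolongs the chain of the others. The long-root row then closes it, with
obstruction `(y ^ 2 - 1) * (y ^ (2 * l + 2) + 1)`. -/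
theorem kernel_C {l : ℕ} (hl : 2 ≤ l) {v : Fin l → ℂ}
    (h : ∀ i : Fin l, ∑ j : Fin l, qnum ħ ((SimpleType.C l hl).form i j * t) * v j = 0) :
    v = 0 := by
  obtain ⟨u, rfl⟩ : ∃ u, t = 2 * u := ⟨t / 2, by ring⟩
  have hu : u ≠ 0 := right_ne_zero_of_mul ht
  have hy := generic_qpow hq hu
  set y := qpow ħ u with hydef
  have hy2 : qpow ħ (2 * u) = y ^ 2 := by exact_mod_cast qpow_nat_mul ħ 2 u
  have hs := qnum_ne_zero hq hu
  have hQ := hy.add_ne_zero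
  obtain ⟨n, rfl⟩ : ∃ n, l = n + 2 := ⟨l - 2, by omega⟩
  set w := extendZero v
  have hw : w (n + 2) = 0 := extendZero_self v
  let g : ℕ → ℕ → ℚ := fun i j => (if i + 1 = n + 2 then 1 else 1 / 2) *
    (if i = j then 2 else if i + 1 = j then (if j = n + 2 - 1 then -2 else -1)
      else if j + 1 = i then -1 else 0)
  have hsum : ∀ i, i < n + 2 →
      ∑ j ∈ Finset.range (n + 2), qnum ħ (g i j * (2 * u)) * w j = 0 := by
    intro i hi
    rw [← h ⟨i, hi⟩]
    symm
    refine sum_fin_eq_sum_range_extendZero v (fun j => qnum ħ _) fun j => ?_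
    simp only [SimpleType.form, SimpleType.cartan, SimpleType.dd, CartanMatrix.C_transpose]
    simp only [CartanMatrix.B, Matrix.of_apply, Fin.ext_iff, g]
    push_cast
    rfl
  have hfar : ∀ i j, j ≠ i → j + 1 ≠ i → i + 1 ≠ j → qnum ħ (g i j * (2 * u)) * w j = 0 := by
    intro i j h2 h3 h4
    simp [g, h2.symm, h3, h4]
  have g2 : ∀ {i j}, g i j = 1 → qnum ħ (g i j * (2 * u)) = (y + y⁻¹) * qnum ħ u := by
    intro i j hij
    rw [hij, one_mul, qnum_two_mul]
  have g2' : ∀ {i j}, g i j = -1 → qnum ħ (g i j * (2 * u)) = -((y + y⁻¹) * qnum ħ u) := by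
    intro i j hij
    rw [hij, neg_one_mul, qnum_neg, qnum_two_mul]
  have g1 : ∀ {i j}, g i j = -1 / 2 → qnum ħ (g i j * (2 * u)) = -qnum ħ u := by
    intro i j hij
    rw [hij, ← qnum_neg]
    ring_nf
  have hrow : ∀ i, i < n →
      (y + y⁻¹) * w i = (if i = 0 then 0 else w (i - 1)) + w (i + 1) := by
    intro i hi
    have h1 := hsum i (by omega)
    rw [sum_range_tridiagonal (i := i) (by omega) (by rw [hw, mul_zero]) (hfar i),
      g2 (i := i) (j := i) (by simp only [g]; grind),
      g1 (i := i) (j := i + 1) (by simp only [g]; grind)] at h1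
    apply mul_left_cancel₀ hs
    rcases i with _ | i
    · rw [if_pos rfl] at h1 ⊢
      linear_combination h1
    · rw [if_neg i.succ_ne_zero, Nat.add_sub_cancel,
        g1 (i := i + 1) (j := i) (by simp only [g]; grind)] at h1
      rw [if_neg i.succ_ne_zero, Nat.add_sub_cancel]
      linear_combination h1
  have hpen : (y + y⁻¹) * w n = (if n = 0 then 0 else w (n - 1)) + (y + y⁻¹) * w (n + 1) := by
    have h1 := hsum n (by omega)
    rw [sum_range_tridiagonal (i := n) (by omega) (by rw [hw, mul_zero]) (hfar n),
      g2 (i := n) (j := n) (by simp only [g]; grind),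
      g2' (i := n) (j := n + 1) (by simp only [g]; grind)] at h1
    apply mul_left_cancel₀ hs
    rcases n with _ | n
    · rw [if_pos rfl] at h1 ⊢
      linear_combination h1
    · rw [if_neg n.succ_ne_zero, Nat.add_sub_cancel, g1 (by simp only [g]; grind)] at h1
      rw [if_neg n.succ_ne_zero, Nat.add_sub_cancel]
      linear_combination h1
  have hlast : (y ^ 2 + y⁻¹ ^ 2) * w (n + 1) = w n := by
    have h1 := hsum (n + 1) (by omega)
    rw [sum_range_tridiagonal (i := n + 1) (by omega) (by rw [hw, mul_zero]) (hfar _), hw,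
      if_neg n.succ_ne_zero, Nat.add_sub_cancel, g2' (by simp only [g]; grind),
      show g (n + 1) (n + 1) = 2 by simp [g], qnum_two_mul, qnum_two_mul, hy2, ← hydef] at h1
    apply mul_left_cancel₀ (mul_ne_zero hQ hs)
    rw [inv_pow]
    linear_combination h1
  have hyy : ∀ m, y ^ m * y⁻¹ ^ m = 1 := fun m => by
    rw [← mul_pow, mul_inv_cancel₀ hy.ne_zero, one_pow]
  have hn1 : (y - y⁻¹) * ((y + y⁻¹) * w (n + 1)) = (y ^ (n + 2) - y⁻¹ ^ (n + 2)) * w 0 := by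
    have h1 := hy.chain_solution hrow (i := n) le_rfl
    rcases n with _ | n
    · rw [if_pos rfl] at hpen
      rw [← zero_add ((y + y⁻¹) * w (0 + 1)), ← hpen]
      ring
    · have h2 := hy.chain_solution hrow (i := n) (by omega)
      rw [if_neg n.succ_ne_zero, Nat.add_sub_cancel] at hpen
      linear_combination (y - y⁻¹) * -hpen + (y + y⁻¹) * h1 - h2 +
        (y ^ (n + 1) - y⁻¹ ^ (n + 1)) * w 0 * hyy 1
  have h0 : w 0 = 0 := by
    have h2 := hy.chain_solution hrow (i := n) le_rfl
    have h3 : (y ^ (n + 4) - y⁻¹ ^ (n + 4) - (y ^ (n + 2) - y⁻¹ ^ (n + 2))) * w 0 = 0 := by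
      linear_combination (-(y ^ 2 + y⁻¹ ^ 2)) * hn1 + (y + y⁻¹) * h2 +
        (y - y⁻¹) * (y + y⁻¹) * hlast -
        (y * y⁻¹) * (y ^ n - y⁻¹ ^ n) * w 0 * hyy 1
    refine (mul_eq_zero.1 h3).resolve_left fun h4 => ?_
    have h5 : (y ^ 2 - 1) * (y ^ (2 * n + 6) + 1) = 0 := by
      linear_combination y ^ (n + 4) * h4 + hyy (n + 4) - y ^ 2 * hyy (n + 2)
    rcases mul_eq_zero.1 h5 with h6 | h6
    · exact hy.pow_ne_one 2 two_pos (by linear_combination h6)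
    · exact hy.pow_ne_neg_one (n := 2 * n + 6) (by omega) (by linear_combination h6)
  refine eq_zero_of_extendZero fun m hm => ?_
  rcases Nat.lt_succ_iff_lt_or_eq.1 hm with h1 | rfl
  · exact hy.chain_eq_zero hrow h0 (by omega)
  · rw [h0, mul_zero, mul_eq_zero, mul_eq_zero] at hn1
    have h2 : y - y⁻¹ ≠ 0 := by simpa using hy.sub_ne_zero one_pos
    exact (hn1.resolve_left h2).resolve_left hQ

/-- The long arm up to the branch node `n + 1` is a chain. With `Q = y + y⁻¹`, eliminating the two
leaves gives `(Q ^ 2 - 2) * w (n + 1) = Q * w n`, with obstruction `(y ^ 2 - 1) * (y ^ (2 * l - 2) +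
1)`. -/
theorem kernel_D {l : ℕ} (hl : 4 ≤ l) {v : Fin l → ℂ}
    (h : ∀ i : Fin l, ∑ j : Fin l, qnum ħ ((SimpleType.D l hl).form i j * t) * v j = 0) :
    v = 0 := by
  have hy := generic_qpow hq ht
  set y := qpow ħ t with hydef
  have hs := qnum_ne_zero hq ht
  have hQ := hy.add_ne_zero
  obtain ⟨n, rfl⟩ : ∃ n, l = n + 4 := ⟨l - 4, by omega⟩
  set w := extendZero v
  let g : ℕ → ℕ → ℚ := fun i j => if i = j then 2 else
    if i + 1 = j ∧ j + 2 < n + 4 then -1 else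
    if j + 1 = i ∧ i + 2 < n + 4 then -1 else
    if i + 3 = n + 4 ∧ (j + 2 = n + 4 ∨ j + 1 = n + 4) then -1 else
    if j + 3 = n + 4 ∧ (i + 2 = n + 4 ∨ i + 1 = n + 4) then -1 else 0
  have hsum : ∀ i, i < n + 4 → ∑ j ∈ Finset.range (n + 4), qnum ħ (g i j * t) * w j = 0 := by
    intro i hi
    rw [← h ⟨i, hi⟩]
    symm
    refine sum_fin_eq_sum_range_extendZero v (fun j => qnum ħ _) fun j => ?_
    simp only [SimpleType.form, SimpleType.cartan, SimpleType.dd, CartanMatrix.D_transpose]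
    simp only [CartanMatrix.D, Matrix.of_apply, Fin.ext_iff, one_mul, g]
    rw [if_neg (by omega : ¬ n + 4 ≤ 2)]
    push_cast
    rfl
  have g2 : ∀ i, qnum ħ (g i i * t) = (y + y⁻¹) * qnum ħ t := by
    intro i
    rw [show g i i = 2 by simp [g], qnum_two_mul]
  have g1 : ∀ {i j}, g i j = -1 → qnum ħ (g i j * t) = -qnum ħ t := by
    intro i j hij
    rw [hij, neg_one_mul, qnum_neg]
  have g0 : ∀ {i j}, g i j = 0 → qnum ħ (g i j * t) = 0 := by
    intro i j hij
    rw [hij, zero_mul, qnum_zero]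
  have hrow : ∀ i, i < n + 1 →
      (y + y⁻¹) * w i = (if i = 0 then 0 else w (i - 1)) + w (i + 1) := by
    intro i hi
    have h1 := hsum i (by omega)
    rw [sum_range_tridiagonal (i := i) (by omega), g2, g1 (i := i) (j := i + 1) (by simp only [g]; grind)] at h1
    · apply mul_left_cancel₀ hs
      rcases i with _ | i
      · rw [if_pos rfl] at h1 ⊢
        linear_combination h1
      · rw [if_neg i.succ_ne_zero, Nat.add_sub_cancel,
        g1 (i := i + 1) (j := i) (by simp only [g]; grind)] at h1
        rw [if_neg i.succ_ne_zero, Nat.add_sub_cancel]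
        linear_combination h1
    · rw [show w (n + 4) = 0 from extendZero_self v, mul_zero]
    · intro j h2 h3 h4
      rw [g0 (by simp only [g]; grind), zero_mul]
  have hsub : ∀ (i : ℕ) (S : Finset ℕ), i < n + 4 → S ⊆ Finset.range (n + 4) →
      (∀ j < n + 4, j ∉ S → g i j = 0) → ∑ j ∈ S, qnum ħ (g i j * t) * w j = 0 := by
    intro i S hi hS h1
    rw [← hsum i hi]
    refine Finset.sum_subset hS fun j hj hjS => ?_
    rw [g0 (h1 j (Finset.mem_range.1 hj) hjS), zero_mul]
  have hbranch : (y + y⁻¹) * w (n + 1) = w n + w (n + 2) + w (n + 3) := by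
    have h1 := hsub (n + 1) {n, n + 1, n + 2, n + 3} (by omega)
      (by intro j; simp only [Finset.mem_insert, Finset.mem_singleton, Finset.mem_range]; omega)
      (by
        intro j hj hjS
        simp only [Finset.mem_insert, Finset.mem_singleton, not_or] at hjS
        simp only [g]; grind)
    rw [Finset.sum_insert (by simp), Finset.sum_insert (by simp), Finset.sum_pair (by simp), g2,
      g1 (by simp only [g]; grind), g1 (by simp only [g]; grind), g1 (by simp only [g]; grind)]
      at h1
    apply mul_left_cancel₀ hs
    linear_combination h1
  have hend : (y + y⁻¹) * w (n + 2) = w (n + 1) := by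
    have h1 := hsub (n + 2) {n + 1, n + 2} (by omega)
      (by intro j; simp only [Finset.mem_insert, Finset.mem_singleton, Finset.mem_range]; omega)
      (by
        intro j hj hjS
        simp only [Finset.mem_insert, Finset.mem_singleton, not_or] at hjS
        simp only [g]; grind)
    rw [Finset.sum_pair (by simp), g2, g1 (by simp only [g]; grind)] at h1
    apply mul_left_cancel₀ hs
    linear_combination h1
  have hend' : (y + y⁻¹) * w (n + 3) = w (n + 1) := by
    have h1 := hsub (n + 3) {n + 1, n + 3} (by omega)
      (by intro j; simp only [Finset.mem_insert, Finset.mem_singleton, Finset.mem_range]; omega)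
      (by
        intro j hj hjS
        simp only [Finset.mem_insert, Finset.mem_singleton, not_or] at hjS
        simp only [g]; grind)
    rw [Finset.sum_pair (by simp), g2, g1 (by simp only [g]; grind)] at h1
    apply mul_left_cancel₀ hs
    linear_combination h1
  have hyy : ∀ m, y ^ m * y⁻¹ ^ m = 1 := fun m => by
    rw [← mul_pow, mul_inv_cancel₀ hy.ne_zero, one_pow]
  have h0 : w 0 = 0 := by
    have h1 := hy.chain_solution hrow (i := n + 1) le_rfl
    have h2 := hy.chain_solution hrow (i := n) (by omega)
    have h3 : (y ^ (n + 4) - y⁻¹ ^ (n + 4) - (y ^ (n + 2) - y⁻¹ ^ (n + 2))) * w 0 = 0 := by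
      have h4 : ((y + y⁻¹) ^ 2 - 2) * w (n + 1) = (y + y⁻¹) * w n := by
        linear_combination (y + y⁻¹) * hbranch + hend + hend'
      linear_combination (y - y⁻¹) * h4 - ((y + y⁻¹) ^ 2 - 2) * h1 + (y + y⁻¹) * h2 +
        (-2 * (y ^ (n + 2) - y⁻¹ ^ (n + 2)) - y * y⁻¹ * (y ^ n - y⁻¹ ^ n)) * w 0 * hyy 1
    refine (mul_eq_zero.1 h3).resolve_left fun h4 => ?_
    have h5 : (y ^ 2 - 1) * (y ^ (2 * n + 6) + 1) = 0 := by
      linear_combination y ^ (n + 4) * h4 + hyy (n + 4) - y ^ 2 * hyy (n + 2)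
    rcases mul_eq_zero.1 h5 with h6 | h6
    · exact hy.pow_ne_one 2 two_pos (by linear_combination h6)
    · exact hy.pow_ne_neg_one (n := 2 * n + 6) (by omega) (by linear_combination h6)
  have hz : ∀ i ≤ n + 1, w i = 0 := fun i hi => hy.chain_eq_zero hrow h0 hi
  rw [hz (n + 1) le_rfl, mul_eq_zero] at hend hend'
  refine eq_zero_of_extendZero fun m hm => ?_
  obtain h1 | rfl | rfl : m ≤ n + 1 ∨ m = n + 2 ∨ m = n + 3 := by omega
  · exact hz m h1
  · exact hend.resolve_left hQ
  · exact hend'.resolve_left hQ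

end Nondegenerate

section Nondegenerate

/-- Elimination of the two short legs of a Dynkin diagram of type `E`. -/
theorem branch_elimination {Q v₀ v₁ v₂ v₃ v₄ : ℂ} (h0 : Q * v₀ = v₂) (h1 : Q * v₁ = v₃)
    (h2 : Q * v₂ = v₀ + v₃) (h3 : Q * v₃ = v₁ + v₂ + v₄) :
    (Q ^ 4 - 3 * Q ^ 2 + 1) * v₃ = (Q ^ 3 - Q) * v₄ := by
  linear_combination (Q ^ 3 - Q) * h3 + (Q ^ 2 - 1) * h1 + Q ^ 2 * h2 + Q * h0

/-- A zero at the branch node decouples the legs into systems of types `A₂` and `A₁`. -/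
theorem Generic.short_legs_eq_zero {y v₀ v₁ v₂ v₃ : ℂ} (hy : Generic y)
    (h0 : (y + y⁻¹) * v₀ = v₂) (h1 : (y + y⁻¹) * v₁ = v₃) (h2 : (y + y⁻¹) * v₂ = v₀ + v₃)
    (h3 : v₃ = 0) : v₀ = 0 ∧ v₁ = 0 ∧ v₂ = 0 := by
  have h4 : ((y + y⁻¹) ^ 2 - 1) * v₀ = 0 := by
    linear_combination (y + y⁻¹) * h0 + h2 + h3
  have hv0 := (mul_eq_zero.1 h4).resolve_left hy.add_sq_sub_one_ne_zero
  rw [h3, mul_eq_zero] at h1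
  rw [hv0, mul_zero] at h0
  exact ⟨hv0, h1.resolve_left hy.add_ne_zero, h0.symm⟩

variable {ħ : ℂ} (hq : ∀ n : ℕ, 0 < n → Complex.exp ħ ^ n ≠ 1) {t : ℚ} (ht : t ≠ 0)
include hq ht

/-- In all three `E` types node `3` is the branch node and `4, 5, …` the tail. The tail expresses `v
3` and `v 4` as polynomials in `Q` times the last coordinate, and `branch_elimination` closes the
system. Here the essential factor is the 24th cyclotomic polynomial in `y`, a divisor of `y ^ 12 +
1`. -/
theorem kernel_E6 {v : Fin 6 → ℂ}
    (h : ∀ i : Fin 6, ∑ j : Fin 6, qnum ħ (SimpleType.E6.form i j * t) * v j = 0) : v = 0 := by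
  have hy := generic_qpow hq ht
  have hs := qnum_ne_zero hq ht
  have r0 := h 0
  have r1 := h 1
  have r2 := h 2
  have r3 := h 3
  have r4 := h 4
  have r5 := h 5
  simp [Fin.sum_univ_succ, SimpleType.form, SimpleType.cartan, SimpleType.dd, CartanMatrix.E₆,
    qnum_neg, qnum_two_mul] at r0 r1 r2 r3 r4 r5
  set y := qpow ħ t
  have h0 : (y + y⁻¹) * v 0 = v 2 := mul_left_cancel₀ hs (by linear_combination r0)
  have h1 : (y + y⁻¹) * v 1 = v 3 := mul_left_cancel₀ hs (by linear_combination r1)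
  have h2 : (y + y⁻¹) * v 2 = v 0 + v 3 := mul_left_cancel₀ hs (by linear_combination r2)
  have h3 : (y + y⁻¹) * v 3 = v 1 + v 2 + v 4 := mul_left_cancel₀ hs (by linear_combination r3)
  have h4 : (y + y⁻¹) * v 4 = v 3 + v 5 := mul_left_cancel₀ hs (by linear_combination r4)
  have h5 : (y + y⁻¹) * v 5 = v 4 := mul_left_cancel₀ hs (by linear_combination r5)
  have hb := branch_elimination h0 h1 h2 h3
  have hy0 := hy.ne_zero
  set Q := y + y⁻¹ with hQ
  have e3 : v 3 = (Q ^ 2 - 1) * v 5 := by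
    linear_combination -h4 + Q * (-h5)
  have hF : ((Q ^ 2 - 1) * (Q ^ 4 - 4 * Q ^ 2 + 1)) * v 5 = 0 := by
    linear_combination hb - (Q ^ 4 - 3 * Q ^ 2 + 1) * e3 + (Q ^ 3 - Q) * (-h5)
  have hv : v 5 = 0 := by
    refine (mul_eq_zero.1 hF).resolve_left fun hz => ?_
    refine hy.pow_ne_neg_one (n := 12) (by norm_num) ?_
    have hz' := (mul_eq_zero.1 hz).resolve_left hy.add_sq_sub_one_ne_zero
    have h6 : y ^ 8 - y ^ 4 + 1 = 0 := by
      have h7 : y ^ 8 - y ^ 4 + 1 = y ^ 4 * (Q ^ 4 - 4 * Q ^ 2 + 1) := by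
        rw [hQ]
        field_simp
        ring
      rw [h7, hz', mul_zero]
    linear_combination (y ^ 4 + 1) * h6
  have hv3 : v 3 = 0 := by rw [e3, hv, mul_zero]
  obtain ⟨hv0, hv1, hv2⟩ := hy.short_legs_eq_zero h0 h1 h2 hv3
  have hv4 : v 4 = 0 := by rw [← h5, hv, mul_zero]
  ext i
  fin_cases i <;> assumption

theorem kernel_E7 {v : Fin 7 → ℂ}
    (h : ∀ i : Fin 7, ∑ j : Fin 7, qnum ħ (SimpleType.E7.form i j * t) * v j = 0) : v = 0 := by
  have hy := generic_qpow hq ht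
  have hs := qnum_ne_zero hq ht
  have r0 := h 0
  have r1 := h 1
  have r2 := h 2
  have r3 := h 3
  have r4 := h 4
  have r5 := h 5
  have r6 := h 6
  simp [Fin.sum_univ_succ, SimpleType.form, SimpleType.cartan, SimpleType.dd, CartanMatrix.E₇,
    qnum_neg, qnum_two_mul] at r0 r1 r2 r3 r4 r5 r6
  set y := qpow ħ t
  have h0 : (y + y⁻¹) * v 0 = v 2 := mul_left_cancel₀ hs (by linear_combination r0)
  have h1 : (y + y⁻¹) * v 1 = v 3 := mul_left_cancel₀ hs (by linear_combination r1)
  have h2 : (y + y⁻¹) * v 2 = v 0 + v 3 := mul_left_cancel₀ hs (by linear_combination r2)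
  have h3 : (y + y⁻¹) * v 3 = v 1 + v 2 + v 4 := mul_left_cancel₀ hs (by linear_combination r3)
  have h4 : (y + y⁻¹) * v 4 = v 3 + v 5 := mul_left_cancel₀ hs (by linear_combination r4)
  have h5 : (y + y⁻¹) * v 5 = v 4 + v 6 := mul_left_cancel₀ hs (by linear_combination r5)
  have h6 : (y + y⁻¹) * v 6 = v 5 := mul_left_cancel₀ hs (by linear_combination r6)
  have hb := branch_elimination h0 h1 h2 h3
  have hy0 := hy.ne_zero
  set Q := y + y⁻¹ with hQ
  have e4 : v 4 = (Q ^ 2 - 1) * v 6 := by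
    linear_combination -h5 + Q * (-h6)
  have e3 : v 3 = (Q ^ 3 - 2 * Q) * v 6 := by
    linear_combination -h4 + Q * e4 + h6
  have hF : (Q * (Q ^ 6 - 6 * Q ^ 4 + 9 * Q ^ 2 - 3)) * v 6 = 0 := by
    linear_combination hb - (Q ^ 4 - 3 * Q ^ 2 + 1) * e3 + (Q ^ 3 - Q) * e4
  have hv : v 6 = 0 := by
    refine (mul_eq_zero.1 hF).resolve_left fun hz => ?_
    refine hy.pow_ne_neg_one (n := 18) (by norm_num) ?_
    have hz' := (mul_eq_zero.1 hz).resolve_left hy.add_ne_zero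
    -- The 36th cyclotomic polynomial, a divisor of `y ^ 18 + 1`.
    have h7 : y ^ 12 - y ^ 6 + 1 = 0 := by
      have h8 : y ^ 12 - y ^ 6 + 1 = y ^ 6 * (Q ^ 6 - 6 * Q ^ 4 + 9 * Q ^ 2 - 3) := by
        rw [hQ]
        field_simp
        ring
      rw [h8, hz', mul_zero]
    linear_combination (y ^ 6 + 1) * h7
  have hv3 : v 3 = 0 := by rw [e3, hv, mul_zero]
  obtain ⟨hv0, hv1, hv2⟩ := hy.short_legs_eq_zero h0 h1 h2 hv3
  have hv4 : v 4 = 0 := by rw [e4, hv, mul_zero]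
  have hv5 : v 5 = 0 := by rw [← h6, hv, mul_zero]
  ext i
  fin_cases i <;> assumption

theorem kernel_E8 {v : Fin 8 → ℂ}
    (h : ∀ i : Fin 8, ∑ j : Fin 8, qnum ħ (SimpleType.E8.form i j * t) * v j = 0) : v = 0 := by
  have hy := generic_qpow hq ht
  have hs := qnum_ne_zero hq ht
  have r0 := h 0
  have r1 := h 1
  have r2 := h 2
  have r3 := h 3
  have r4 := h 4
  have r5 := h 5
  have r6 := h 6
  have r7 := h 7
  simp [Fin.sum_univ_succ, SimpleType.form, SimpleType.cartan, SimpleType.dd, CartanMatrix.E₈,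
    qnum_neg, qnum_two_mul] at r0 r1 r2 r3 r4 r5 r6 r7
  set y := qpow ħ t
  have h0 : (y + y⁻¹) * v 0 = v 2 := mul_left_cancel₀ hs (by linear_combination r0)
  have h1 : (y + y⁻¹) * v 1 = v 3 := mul_left_cancel₀ hs (by linear_combination r1)
  have h2 : (y + y⁻¹) * v 2 = v 0 + v 3 := mul_left_cancel₀ hs (by linear_combination r2)
  have h3 : (y + y⁻¹) * v 3 = v 1 + v 2 + v 4 := mul_left_cancel₀ hs (by linear_combination r3)
  have h4 : (y + y⁻¹) * v 4 = v 3 + v 5 := mul_left_cancel₀ hs (by linear_combination r4)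
  have h5 : (y + y⁻¹) * v 5 = v 4 + v 6 := mul_left_cancel₀ hs (by linear_combination r5)
  have h6 : (y + y⁻¹) * v 6 = v 5 + v 7 := mul_left_cancel₀ hs (by linear_combination r6)
  have h7 : (y + y⁻¹) * v 7 = v 6 := mul_left_cancel₀ hs (by linear_combination r7)
  have hb := branch_elimination h0 h1 h2 h3
  have hy0 := hy.ne_zero
  set Q := y + y⁻¹ with hQ
  have e5 : v 5 = (Q ^ 2 - 1) * v 7 := by
    linear_combination -h6 + Q * (-h7)
  have e4 : v 4 = (Q ^ 3 - 2 * Q) * v 7 := by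
    linear_combination -h5 + Q * e5 + h7
  have e3 : v 3 = (Q ^ 4 - 3 * Q ^ 2 + 1) * v 7 := by
    linear_combination -h4 + Q * e4 - e5
  have hF : ((Q ^ 4 - 3 * Q ^ 2 + 1) ^ 2 - (Q ^ 3 - Q) * (Q ^ 3 - 2 * Q)) * v 7 = 0 := by
    linear_combination hb - (Q ^ 4 - 3 * Q ^ 2 + 1) * e3 + (Q ^ 3 - Q) * e4
  have hv : v 7 = 0 := by
    refine (mul_eq_zero.1 hF).resolve_left fun hz => ?_
    -- The 60th cyclotomic polynomial. It divides `y ^ 30 + 1`; the extra factor `y ^ 2 + 1` below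
    -- makes the cofactor the product `(y ^ 6 + 1) * (y ^ 10 + 1)`.
    have h8 : y ^ 16 + y ^ 14 - y ^ 10 - y ^ 8 - y ^ 6 + y ^ 2 + 1 = 0 := by
      have h9 : y ^ 16 + y ^ 14 - y ^ 10 - y ^ 8 - y ^ 6 + y ^ 2 + 1 =
          y ^ 8 * ((Q ^ 4 - 3 * Q ^ 2 + 1) ^ 2 - (Q ^ 3 - Q) * (Q ^ 3 - 2 * Q)) := by
        rw [hQ]
        field_simp
        ring
      rw [h9, hz, mul_zero]
    have h10 : (y ^ 30 + 1) * (y ^ 2 + 1) = 0 := by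
      linear_combination (y ^ 6 + 1) * (y ^ 10 + 1) * h8
    rcases mul_eq_zero.1 h10 with h11 | h11
    · exact hy.pow_ne_neg_one (n := 30) (by norm_num) (by linear_combination h11)
    · exact hy.pow_ne_neg_one (n := 2) (by norm_num) (by linear_combination h11)
  have hv3 : v 3 = 0 := by rw [e3, hv, mul_zero]
  obtain ⟨hv0, hv1, hv2⟩ := hy.short_legs_eq_zero h0 h1 h2 hv3
  have hv4 : v 4 = 0 := by rw [e4, hv, mul_zero]
  have hv5 : v 5 = 0 := by rw [e5, hv, mul_zero]
  have hv6 : v 6 = 0 := by rw [← h7, hv, mul_zero]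
  ext i
  fin_cases i <;> assumption

/-- With `y = q^(t/2)`, the long rows involve `R = y ^ 2 + y⁻²` and the short rows `y + y⁻¹`; the
relation `(y + y⁻¹) ^ 2 = R + 2` merges them into a cubic in `R`, which is `y⁻⁶` times the 36th
cyclotomic polynomial. -/
theorem kernel_F4 {v : Fin 4 → ℂ}
    (h : ∀ i : Fin 4, ∑ j : Fin 4, qnum ħ (SimpleType.F4.form i j * t) * v j = 0) : v = 0 := by
  obtain ⟨u, rfl⟩ : ∃ u, t = 2 * u := ⟨t / 2, by ring⟩
  have hu : u ≠ 0 := right_ne_zero_of_mul ht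
  have hy := generic_qpow hq hu
  have hs := qnum_ne_zero hq hu
  have hy2 : qpow ħ (2 * u) = qpow ħ u ^ 2 := by exact_mod_cast qpow_nat_mul ħ 2 u
  have r0 := h 0
  have r1 := h 1
  have r2 := h 2
  have r3 := h 3
  simp [Fin.sum_univ_succ, SimpleType.form, SimpleType.cartan, SimpleType.dd, CartanMatrix.F₄,
    qnum_neg, qnum_two_mul, hy2] at r0 r1 r2 r3
  set y := qpow ħ u
  have hQ := hy.add_ne_zero
  have hy0 := hy.ne_zero
  have hQs := mul_ne_zero hQ hs
  set R := y ^ 2 + (y ^ 2)⁻¹ with hR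
  have h0 : R * v 0 = v 1 := mul_left_cancel₀ hQs (by linear_combination r0)
  have h1 : R * v 1 = v 0 + v 2 := mul_left_cancel₀ hQs (by linear_combination r1)
  have h2 : (y + y⁻¹) * v 2 = (y + y⁻¹) * v 1 + v 3 :=
    mul_left_cancel₀ hs (by linear_combination r2)
  have h3 : (y + y⁻¹) * v 3 = v 2 := mul_left_cancel₀ hs (by linear_combination r3)
  have hQR : (y + y⁻¹) ^ 2 = R + 2 := by
    rw [hR]
    field_simp
    ring
  have hF : (R ^ 3 - 3 * R - 1) * v 0 = 0 := by
    have e2 : v 2 = (R ^ 2 - 1) * v 0 := by linear_combination -R * h0 - h1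
    have e3 : (R + 1) * v 2 = (R + 2) * v 1 := by
      linear_combination (y + y⁻¹) * h2 + h3 + (v 1 - v 2) * hQR
    linear_combination e3 - (R + 1) * e2 - (R + 2) * h0
  have hv0 : v 0 = 0 := by
    refine (mul_eq_zero.1 hF).resolve_left fun hz => ?_
    refine hy.pow_ne_neg_one (n := 18) (by norm_num) ?_
    have h6 : y ^ 12 - y ^ 6 + 1 = 0 := by
      have h7 : y ^ 12 - y ^ 6 + 1 = y ^ 6 * (R ^ 3 - 3 * R - 1) := by
        rw [hR]
        field_simp
        ring
      rw [h7, hz, mul_zero]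
    linear_combination (y ^ 6 + 1) * h6
  have hv1 : v 1 = 0 := by rw [← h0, hv0, mul_zero]
  have hv2 : v 2 = 0 := by linear_combination -h1 + R * hv1 - hv0
  have hv3 : v 3 = 0 := by linear_combination -h2 + (y + y⁻¹) * (hv2 - hv1)
  ext i
  fin_cases i <;> assumption

/-- With `y = q^(t/3)`, eliminating `v 1` leaves the 24th cyclotomic polynomial in `y` as
coefficient of `v 0`. -/
theorem kernel_G2 {v : Fin 2 → ℂ}
    (h : ∀ i : Fin 2, ∑ j : Fin 2, qnum ħ (SimpleType.G2.form i j * t) * v j = 0) : v = 0 := by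
  obtain ⟨u, rfl⟩ : ∃ u, t = 3 * u := ⟨t / 3, by ring⟩
  have hu : u ≠ 0 := right_ne_zero_of_mul ht
  have hy := generic_qpow hq hu
  have hs := qnum_ne_zero hq hu
  have hs3 := qnum_ne_zero hq ht
  have hy3 : qpow ħ (3 * u) = qpow ħ u ^ 3 := by exact_mod_cast qpow_nat_mul ħ 3 u
  have e3 : qnum ħ (3 * u) = (qpow ħ u ^ 2 + 1 + (qpow ħ u ^ 2)⁻¹) * qnum ħ u := by
    have := hy.ne_zero
    rw [qnum, qnum, qpow_neg ħ (3 * u), qpow_neg ħ u, hy3]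
    field_simp
    ring
  have r0 := h 0
  have r1 := h 1
  simp [Fin.sum_univ_succ, SimpleType.form, SimpleType.cartan, SimpleType.dd, CartanMatrix.G₂,
    qnum_neg] at r0 r1
  rw [show (3⁻¹ * 2 * (3 * u) : ℚ) = 2 * u by ring, qnum_two_mul, e3] at r1
  rw [qnum_two_mul, hy3] at r0
  set y := qpow ħ u
  have hy0 := hy.ne_zero
  have h0 : (y ^ 3 + (y ^ 3)⁻¹) * v 0 = v 1 := mul_left_cancel₀ hs3 (by linear_combination r0)
  have h1 : (y ^ 2 + 1 + (y ^ 2)⁻¹) * v 0 = (y + y⁻¹) * v 1 :=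
    mul_left_cancel₀ hs (by linear_combination -r1)
  have hF : (y ^ 8 - y ^ 4 + 1) * v 0 = 0 := by
    rw [← h0] at h1
    field_simp at h1
    linear_combination -h1
  have hv0 : v 0 = 0 := by
    refine (mul_eq_zero.1 hF).resolve_left fun hz => ?_
    refine hy.pow_ne_neg_one (n := 12) (by norm_num) ?_
    linear_combination (y ^ 4 + 1) * hz
  have hv1 : v 1 = 0 := by rw [← h0, hv0, mul_zero]
  ext i
  fin_cases i <;> assumption

omit ht in
/-- The `q`-deformed symmetrized Cartan matrix is nondegenerate. -/
theorem form_kernel (X : SimpleType) (n : ℕ+) {v : X.Idx → ℂ}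
    (h : ∀ i, ∑ j, qnum ħ (X.form i j * (n : ℕ)) * v j = 0) : v = 0 := by
  have hn : ((n : ℕ) : ℚ) ≠ 0 := by exact_mod_cast n.ne_zero
  cases X with
  | A l hl => exact kernel_A hq hn hl h
  | B l hl => exact kernel_B hq hn hl h
  | C l hl => exact kernel_C hq hn hl h
  | D l hl => exact kernel_D hq hn hl h
  | E6 => exact kernel_E6 hq hn h
  | E7 => exact kernel_E7 hq hn h
  | E8 => exact kernel_E8 hq hn h
  | F4 => exact kernel_F4 hq hn h
  | G2 => exact kernel_G2 hq hn h

end Nondegenerate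

/-! ### Representations of the Weyl algebra in infinitely many variables -/

section Weyl

variable {P V : Type*} [AddCommGroup V] [Module ℂ V]

/-- If `[a, φ(X_p)]` is the scalar `s p`, then `[a, φ(u)] = φ(∂ u)` for the derivation `∂` with
`∂ X_p = s p`. -/
theorem commutator_algHom (φ : MvPolynomial P ℂ →ₐ[ℂ] Module.End ℂ V) (a : Module.End ℂ V)
    (s : P → ℂ) (h : ∀ p, a * φ (MvPolynomial.X p) - φ (MvPolynomial.X p) * a = s p • 1)
    (u : MvPolynomial P ℂ) :
    a * φ u - φ u * a =
      φ (MvPolynomial.mkDerivation ℂ (fun p => (MvPolynomial.C (s p) : MvPolynomial P ℂ)) u) := by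
  induction u using MvPolynomial.induction_on with
  | C c =>
    rw [← MvPolynomial.algebraMap_eq, Derivation.map_algebraMap, map_zero, AlgHom.commutes,
      Algebra.commutes, sub_self]
  | add u v hu hv =>
    rw [map_add, map_add, map_add, ← hu, ← hv]
    noncomm_ring
  | mul_X u p hu =>
    rw [Derivation.leibniz, MvPolynomial.mkDerivation_X, smul_eq_mul, smul_eq_mul, map_add,
      map_mul, map_mul, map_mul, ← hu, ← MvPolynomial.algebraMap_eq, AlgHom.commutes,
      Algebra.algebraMap_eq_smul_one, ← h p]
    -- By induction the commutator lies in the commutative image of `φ`.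
    have : φ (MvPolynomial.X p) * (a * φ u - φ u * a) =
        (a * φ u - φ u * a) * φ (MvPolynomial.X p) := by
      rw [hu, ← map_mul, ← map_mul, mul_comm]
    rw [this]
    noncomm_ring

variable (φ : MvPolynomial P ℂ →ₐ[ℂ] Module.End ℂ V) (Ω : Submodule ℂ V)

/-- The map `u ⊗ w ↦ φ(u) w`. -/
def fockMap : MvPolynomial P ℂ ⊗[ℂ] Ω →ₗ[ℂ] V :=
  TensorProduct.lift ((LinearMap.lcomp ℂ V Ω.subtype) ∘ₗ φ.toLinearMap)

@[simp]
theorem fockMap_tmul (u : MvPolynomial P ℂ) (w : Ω) : fockMap φ Ω (u ⊗ₜ[ℂ] w) = φ u (w : V) := by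
  simp [fockMap]

variable {φ Ω} {D : P → Module.End ℂ V}

theorem apply_algHom_of_annihilated {a : Module.End ℂ V} {s : P → ℂ}
    (h : ∀ p, a * φ (MvPolynomial.X p) - φ (MvPolynomial.X p) * a = s p • 1) {w : V} (hw : a w = 0)
    (u : MvPolynomial P ℂ) :
    a (φ u w) =
      φ (MvPolynomial.mkDerivation ℂ (fun p => (MvPolynomial.C (s p) : MvPolynomial P ℂ)) u) w := by
  rw [← commutator_algHom φ a s h u]
  simp [hw]

theorem mkDerivation_single [DecidableEq P] (p : P) :
    MvPolynomial.mkDerivation ℂ (fun r => (MvPolynomial.C ((Pi.single p 1 : P → ℂ) r) :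
      MvPolynomial P ℂ)) = MvPolynomial.pderiv p := by
  refine MvPolynomial.derivation_ext fun r => ?_
  rw [MvPolynomial.mkDerivation_X, MvPolynomial.pderiv_X, Pi.single_apply, Pi.single_apply]
  split_ifs <;> simp

theorem apply_fockMap_pderiv [DecidableEq P] (hΩ : ∀ w ∈ Ω, ∀ p, D p w = 0)
    (hD : ∀ p r, D p * φ (MvPolynomial.X r) - φ (MvPolynomial.X r) * D p = if p = r then 1 else 0)
    (p : P) (t : MvPolynomial P ℂ ⊗[ℂ] Ω) :
    D p (fockMap φ Ω t) =
      fockMap φ Ω ((MvPolynomial.pderiv p).toLinearMap.rTensor Ω t) := by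
  induction t with
  | zero => simp
  | add t t' h h' => simp only [map_add, h, h']
  | tmul u w =>
    rw [fockMap_tmul, apply_algHom_of_annihilated (s := Pi.single p 1) _ (hΩ w w.2 p) u,
      LinearMap.rTensor_tmul, fockMap_tmul]
    · rw [mkDerivation_single, Derivation.coeFn_coe]
    · intro r
      rw [hD]
      by_cases hr : p = r
      · subst hr; simp
      · simp [hr, Ne.symm hr]

/-- `D p` corresponds to `∂/∂X_p` on the polynomial factor, so the kernel is stable under partial
derivatives. By induction on a degree bound the derivatives of a kernel element vanish; in
characteristic zero it is then `1 ⊗ w`, whose image is `w`. -/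
theorem fockMap_injective [DecidableEq P] (hΩ : ∀ w ∈ Ω, ∀ p, D p w = 0)
    (hD : ∀ p r, D p * φ (MvPolynomial.X r) - φ (MvPolynomial.X r) * D p =
      if p = r then 1 else 0) :
    Function.Injective (fockMap φ Ω) := by
  -- A tensor is read as a finitely supported family of vectors of `Ω` indexed by monomials.
  let e := TensorProduct.equivFinsuppOfBasisLeft (N := Ω) (MvPolynomial.basisMonomials P ℂ)
  have he : ∀ u w s, e (u ⊗ₜ w) s = MvPolynomial.coeff s u • w := by
    intro u w s
    simp only [e, TensorProduct.equivFinsuppOfBasisLeft_apply_tmul_apply]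
    rfl
  have hder : ∀ p t s, e ((MvPolynomial.pderiv p).toLinearMap.rTensor Ω t) s =
      ((s p : ℂ) + 1) • e t (s + Finsupp.single p 1) := by
    intro p t s
    induction t with
    | zero => simp
    | add t t' h h' => simp only [map_add, Finsupp.add_apply, smul_add, h, h']
    | tmul u w =>
      rw [LinearMap.rTensor_tmul, he, he, Derivation.coeFn_coe, MvPolynomial.coeff_pderiv,
        smul_smul, mul_comm]
  rw [injective_iff_map_eq_zero]
  suffices H : ∀ (n : ℕ) (t : MvPolynomial P ℂ ⊗[ℂ] Ω), fockMap φ Ω t = 0 →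
      (∀ s, n ≤ s.degree → e t s = 0) → t = 0 by
    intro t ht
    refine H ((e t).support.sup Finsupp.degree + 1) t ht fun s hs => ?_
    by_contra hne
    have := Finset.le_sup (f := Finsupp.degree) (Finsupp.mem_support_iff.2 hne)
    omega
  intro n
  induction n with
  | zero =>
    intro t _ h
    apply e.injective
    ext1 s
    rw [h s (Nat.zero_le _), map_zero, Finsupp.zero_apply]
  | succ n ih =>
    intro t ht h
    have h1 : ∀ p s, e t (s + Finsupp.single p 1) = 0 := by
      intro p s
      have h2 : (MvPolynomial.pderiv p).toLinearMap.rTensor Ω t = 0 := by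
        apply ih
        · rw [← apply_fockMap_pderiv hΩ hD, ht, map_zero]
        · intro s hs
          rw [hder, h, smul_zero]
          rw [map_add, Finsupp.degree_single]
          omega
      have h3 := hder p t s
      rw [h2, map_zero, Finsupp.zero_apply, eq_comm, smul_eq_zero] at h3
      exact h3.resolve_left (by exact_mod_cast (s p).succ_ne_zero)
    have h4 : t = 1 ⊗ₜ e t 0 := by
      apply e.injective
      ext1 s
      rw [he, MvPolynomial.coeff_one]
      split_ifs with hs
      · rw [← hs, one_smul]
      · rw [zero_smul]
        obtain ⟨p, hp⟩ := Finsupp.ne_iff.1 (Ne.symm hs)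
        have : s = (s - Finsupp.single p 1) + Finsupp.single p 1 := by
          rw [tsub_add_cancel_of_le]
          rw [Finsupp.single_le_iff]
          exact Nat.one_le_iff_ne_zero.2 hp
        rw [this, h1]
    rw [h4, fockMap_tmul, map_one, Module.End.one_apply, Submodule.coe_eq_zero] at ht
    rw [h4, ht, TensorProduct.tmul_zero]

theorem pow_commutator_apply {S : Type*} [Ring S] {a b : S} (h : a * b - b * a = 1) (N : ℕ) :
    a * b ^ N = b ^ N * a + N • b ^ (N - 1) := by
  cases N with
  | zero => simp
  | succ N =>
    have := commutator_pow h (Commute.one_left b) N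
    rw [one_mul] at this
    rw [Nat.add_sub_cancel, ← this]
    abel

theorem pow_apply_pow_of_annihilated {a b : Module.End ℂ V} (h : a * b - b * a = 1) {u : V}
    (hu : a u = 0) (N : ℕ) : (a ^ N) ((b ^ N) u) = N.factorial • u := by
  induction N with
  | zero => simp
  | succ N ih =>
    rw [pow_succ a N, Module.End.mul_apply]
    have := congrArg (fun f : Module.End ℂ V => f u) (pow_commutator_apply h (N + 1))
    simp only [Module.End.mul_apply, LinearMap.add_apply, hu, map_zero, zero_add,
      LinearMap.smul_apply, Nat.add_sub_cancel] at this
    rw [this, map_nsmul, ih, smul_smul, Nat.factorial_succ]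

/-- Double induction: on a finite set containing every `p` with `D p v ≠ 0`, then on the nilpotency
order of one such `D p` on `v`. The vector `u = D_p^N v` is killed by `D p`, hence is in the range
by the outer induction; subtracting a multiple of `X_p^N u` lowers the order. -/
theorem fockMap_surjective [DecidableEq P] (hΩ : ∀ w, (∀ p, D p w = 0) → w ∈ Ω)
    (hD : ∀ p r, D p * φ (MvPolynomial.X r) - φ (MvPolynomial.X r) * D p =
      if p = r then 1 else 0)
    (hDD : ∀ p r, Commute (D p) (D r)) (hnil : ∀ p v, ∃ N : ℕ, (D p ^ N) v = 0)
    (hfin : ∀ v, {p | D p v ≠ 0}.Finite) :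
    Function.Surjective (fockMap φ Ω) := by
  have hX : ∀ u v, v ∈ LinearMap.range (fockMap φ Ω) → φ u v ∈ LinearMap.range (fockMap φ Ω) := by
    rintro u _ ⟨t, rfl⟩
    refine ⟨(LinearMap.mulLeft ℂ u).rTensor Ω t, ?_⟩
    induction t with
    | zero => simp
    | add t t' h h' => simp only [map_add, h, h']
    | tmul u' w => simp
  suffices H : ∀ (S : Finset P) (v : V), (∀ p ∉ S, D p v = 0) →
      v ∈ LinearMap.range (fockMap φ Ω) by
    intro v
    refine H (hfin v).toFinset v fun p hp => ?_
    simpa using hp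
  intro S
  induction S using Finset.induction_on with
  | empty =>
    intro v hv
    exact ⟨1 ⊗ₜ ⟨v, hΩ v fun p => hv p (Finset.notMem_empty p)⟩, by simp⟩
  | insert p S hp ih =>
    suffices H : ∀ (N : ℕ) (v : V), (D p ^ N) v = 0 → (∀ r ∉ insert p S, D r v = 0) →
        v ∈ LinearMap.range (fockMap φ Ω) by
      intro v hv
      obtain ⟨N, hN⟩ := hnil p v
      exact H N v hN hv
    intro N
    induction N with
    | zero =>
      intro v hv _
      rw [pow_zero, Module.End.one_apply] at hv
      rw [hv]
      exact zero_mem _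
    | succ N ihN =>
      intro v hv hr
      set u := (D p ^ N) v with hu
      have hpu : D p u = 0 := by
        rw [hu, ← Module.End.mul_apply, ← pow_succ', hv]
      have hru : ∀ r ∉ insert p S, D r u = 0 := by
        intro r hrS
        rw [hu, ← Module.End.mul_apply, ((hDD r p).pow_right N).eq, Module.End.mul_apply, hr r hrS,
          map_zero]
      have huW : u ∈ LinearMap.range (fockMap φ Ω) := by
        refine ih u fun r hrS => ?_
        by_cases hrp : r = p
        · rw [hrp, hpu]
        · exact hru r (by simp [hrp, hrS])
      have hXu := hX (MvPolynomial.X p ^ N) u huW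
      -- The factor `1 / N!` comes from `D_p^N X_p^N u = N! u`, valid because `D_p u = 0`.
      have hsub : v - ((N.factorial : ℂ)⁻¹) • φ (MvPolynomial.X p ^ N) u ∈
          LinearMap.range (fockMap φ Ω) := by
        apply ihN
        · rw [map_sub, map_smul, map_pow, pow_apply_pow_of_annihilated _ hpu,
            ← Nat.cast_smul_eq_nsmul ℂ, smul_smul, inv_mul_cancel₀, one_smul, hu, sub_self]
          · exact_mod_cast N.factorial_ne_zero
          · rw [hD, if_pos rfl]
        · intro r hrS
          have hrp : r ≠ p := fun h => hrS (by simp [h])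
          have hc : Commute (D r) (φ (MvPolynomial.X p)) := by
            have := hD r p
            rw [if_neg hrp, sub_eq_zero] at this
            exact this
          rw [map_sub, map_smul, map_pow, ← Module.End.mul_apply, (hc.pow_right N).eq,
            Module.End.mul_apply, hru r hrS, hr r hrS, map_zero, smul_zero, sub_zero]
      have := add_mem hsub (Submodule.smul_mem _ ((N.factorial : ℂ)⁻¹) hXu)
      rwa [sub_add_cancel] at this

end Weyl

/-! ### Dressed fields `A(z) x(z) B(z⁻¹)` -/

theorem finsum_eq_finsum_antidiagonal {M : Type*} [AddCommMonoid M] (f : ℕ × ℕ → M)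
    (hf : (Function.support f).Finite) :
    ∑ᶠ p, f p = ∑ᶠ n, ∑ p ∈ Finset.HasAntidiagonal.antidiagonal n, f p := by
  classical
  obtain ⟨N, hN⟩ : ∃ N, ∀ p ∈ Function.support f, p.1 + p.2 < N := by
    refine ⟨hf.toFinset.sup (fun p => p.1 + p.2) + 1, fun p hp => ?_⟩
    exact Nat.lt_succ_of_le (Finset.le_sup (f := fun p : ℕ × ℕ => p.1 + p.2)
      (hf.mem_toFinset.2 hp))
  rw [finsum_eq_sum_of_support_subset f
      (s := (Finset.range N).biUnion Finset.HasAntidiagonal.antidiagonal),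
    finsum_eq_sum_of_support_subset _ (s := Finset.range N), Finset.sum_biUnion]
  · intro a _ b _ hab
    exact Finset.disjoint_left.2 fun p hp hp' => hab (by
      rw [Finset.HasAntidiagonal.mem_antidiagonal] at hp hp'
      omega)
  · intro n hn
    by_contra h
    refine hn (Finset.sum_eq_zero fun p hp => ?_)
    by_contra hne
    rw [Finset.HasAntidiagonal.mem_antidiagonal] at hp
    have := hN p hne
    simp at h
    omega
  · intro p hp
    simp only [Finset.coe_biUnion, Set.mem_iUnion, Finset.mem_coe, Finset.mem_range,
      Finset.HasAntidiagonal.mem_antidiagonal]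
    exact ⟨_, hN p hp, rfl⟩

section Dressing

variable {V : Type*} [AddCommGroup V] [Module ℂ V]

/-- Every vector is killed by all but finitely many of the operators `B r`. -/
def LocallyFinite (B : ℕ → Module.End ℂ V) : Prop := ∀ v, ∃ R, ∀ r, R ≤ r → B r v = 0

/-- Every vector is killed by the operators `x m` with `m` sufficiently negative. -/
def LocallyBounded (x : ℤ → Module.End ℂ V) : Prop := ∀ v, ∃ M, ∀ m, m ≤ M → x m v = 0

variable {A A' B B' : ℕ → Module.End ℂ V} {x : ℤ → Module.End ℂ V}

theorem LocallyBounded.exists_uniform (hx : LocallyBounded x) (w : ℕ → V) (R : ℕ) :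
    ∃ M, ∀ r < R, ∀ m ≤ M, x m (w r) = 0 := by
  induction R with
  | zero => exact ⟨0, by simp⟩
  | succ R ih =>
    obtain ⟨M, hM⟩ := ih
    obtain ⟨M', hM'⟩ := hx (w R)
    refine ⟨min M M', fun r hr m hm => ?_⟩
    rcases Nat.lt_succ_iff_lt_or_eq.1 hr with h | rfl
    · exact hM r h m (hm.trans (min_le_left _ _))
    · exact hM' m (hm.trans (min_le_right _ _))

theorem LocallyBounded.exists_comp (hx : LocallyBounded x) (hB : LocallyFinite B) (v : V) :
    ∃ (R : ℕ) (M : ℤ), ∀ r m, (R ≤ r ∨ m ≤ M) → x m (B r v) = 0 := by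
  obtain ⟨R, hR⟩ := hB v
  obtain ⟨M, hM⟩ := hx.exists_uniform (fun r => B r v) R
  refine ⟨R, M, fun r m h => ?_⟩
  rcases Nat.lt_or_ge r R with h1 | h1
  · exact hM r h1 m (h.resolve_left (by omega))
  · rw [hR r h1, map_zero]

variable (A B x) in
/-- The summand of the coefficient of `z^m` in `A(z) x(z) B(z⁻¹) v` with indices `(p, r)`. -/
def dressTerm (m : ℤ) (v : V) (pr : ℕ × ℕ) : V := A pr.1 (x (m - pr.1 + pr.2) (B pr.2 v))

/-- Local finiteness of `B` bounds `r`; the lower bound on the index `m - p + r` then bounds `p`. -/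
theorem dressTerm_support_finite (hx : LocallyBounded x) (hB : LocallyFinite B) (m : ℤ) (v : V) :
    (Function.support (dressTerm A B x m v)).Finite := by
  obtain ⟨R, M, h⟩ := hx.exists_comp hB v
  refine (Set.Finite.prod (Set.finite_Iio (m + R - M).toNat) (Set.finite_Iio R)).subset ?_
  rintro ⟨p, r⟩ hpr
  have h1 : ¬ (R ≤ r ∨ m - p + r ≤ M) := by
    intro h2
    exact hpr (by rw [dressTerm, h _ _ h2, map_zero])
  simp only [Set.mem_prod, Set.mem_Iio]
  omega

/-- The coefficient of `z^m` in `A(z) x(z) B(z⁻¹)`. -/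
def dress (A : ℕ → Module.End ℂ V) (hx : LocallyBounded x) (hB : LocallyFinite B) (m : ℤ) :
    Module.End ℂ V where
  toFun v := ∑ᶠ pr, dressTerm A B x m v pr
  map_add' v w := by
    rw [← finsum_add_distrib (dressTerm_support_finite hx hB m v)
      (dressTerm_support_finite hx hB m w)]
    simp only [dressTerm, map_add]
  map_smul' c v := by
    rw [RingHom.id_apply, smul_finsum' c (dressTerm_support_finite hx hB m v)]
    simp only [dressTerm, map_smul]

theorem dress_apply (hx : LocallyBounded x) (hB : LocallyFinite B) (m : ℤ) (v : V) :
    dress A hx hB m v = ∑ᶠ pr, dressTerm A B x m v pr := rfl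

theorem locallyBounded_dress (hx : LocallyBounded x) (hB : LocallyFinite B) :
    LocallyBounded (dress A hx hB) := by
  intro v
  obtain ⟨R, M, h⟩ := hx.exists_comp hB v
  refine ⟨M - R, fun m hm => ?_⟩
  rw [dress_apply, ← finsum_zero (α := ℕ × ℕ)]
  refine finsum_congr fun pr => ?_
  rw [dressTerm, h _ _ (by omega), map_zero]

/-- Dressing with the inverse series undoes the dressing. -/
theorem finsum_dressTerm_dress (hx : LocallyBounded x) (hB : LocallyFinite B)
    (hB' : LocallyFinite B')
    (hA : ∀ n, ∑ p ∈ Finset.HasAntidiagonal.antidiagonal n, A' p.1 * A p.2 =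
      if n = 0 then 1 else 0)
    (hBB : ∀ n, ∑ p ∈ Finset.HasAntidiagonal.antidiagonal n, B p.1 * B' p.2 =
      if n = 0 then 1 else 0) (m : ℤ) (v : V) :
    ∑ᶠ pr, dressTerm A' B' (dress A hx hB) m v pr = x m v := by
  -- Terms of `A'(z) A(z) x(z) B(z⁻¹) B'(z⁻¹) v`. The index of `x` depends only on the total degree
  -- of the two `A` factors and that of the two `B` factors.
  let g : (ℕ × ℕ) × (ℕ × ℕ) → V := fun a =>
    A' a.1.1 (A a.2.1 (x (m - (a.1.1 + a.2.1 : ℕ) + (a.2.2 + a.1.2 : ℕ)) (B a.2.2 (B' a.1.2 v))))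
  have hg : (Function.support g).Finite := by
    obtain ⟨R', hR'⟩ := hB' v
    have hu : ∃ (R : ℕ) (M : ℤ), ∀ r' < R', ∀ r n, (R ≤ r ∨ n ≤ M) →
        x n (B r (B' r' v)) = 0 := by
      clear hR'
      induction R' with
      | zero => exact ⟨0, 0, by simp⟩
      | succ R' ih =>
        obtain ⟨R₁, M₁, h₁⟩ := ih
        obtain ⟨R₂, M₂, h₂⟩ := hx.exists_comp hB (B' R' v)
        refine ⟨max R₁ R₂, min M₁ M₂, fun r' hr' r n h => ?_⟩
        rcases Nat.lt_succ_iff_lt_or_eq.1 hr' with h3 | rfl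
        · exact h₁ r' h3 r n (by omega)
        · exact h₂ r n (by omega)
    obtain ⟨R, M, h⟩ := hu
    refine (Set.Finite.prod
      (Set.Finite.prod (Set.finite_Iio (m + R + R' - M).toNat) (Set.finite_Iio R'))
      (Set.Finite.prod (Set.finite_Iio (m + R + R' - M).toNat) (Set.finite_Iio R))).subset ?_
    rintro ⟨⟨p, r'⟩, ⟨q, r⟩⟩ hpr
    have h0 : r' < R' := by
      by_contra h1
      exact hpr (by simp only [g, hR' r' (by omega), map_zero])
    have h1 : ¬ (R ≤ r ∨ m - (p + q : ℕ) + (r + r' : ℕ) ≤ M) := by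
      intro h2
      exact hpr (by simp only [g, h _ h0 _ _ h2, map_zero])
    simp only [Set.mem_prod, Set.mem_Iio]
    push_cast at h1
    omega
  -- Regrouping pairs `A'` with `A` and `B` with `B'`, so that each convolution collapses to its
  -- degree-zero term.
  let e : (ℕ × ℕ) × (ℕ × ℕ) ≃ (ℕ × ℕ) × (ℕ × ℕ) :=
    { toFun := fun a => ((a.1.1, a.2.2), (a.1.2, a.2.1))
      invFun := fun a => ((a.1.1, a.2.1), (a.2.2, a.1.2))
      left_inv := fun _ => rfl
      right_inv := fun _ => rfl }
  have h1 : ∑ᶠ pr, dressTerm A' B' (dress A hx hB) m v pr = ∑ᶠ a, g a := by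
    rw [finsum_curry g hg]
    refine finsum_congr fun pr => ?_
    rw [dressTerm, dress_apply, ← LinearMap.toAddMonoidHom_coe, AddMonoidHom.map_finsum _
      (dressTerm_support_finite hx hB _ _)]
    refine finsum_congr fun qs => ?_
    simp only [g, dressTerm, LinearMap.toAddMonoidHom_coe]
    congr 4
    push_cast
    ring
  have hge : (Function.support fun a => g (e a)).Finite :=
    Set.Finite.preimage e.injective.injOn hg
  rw [h1, ← finsum_comp_equiv e, finsum_curry _ hge]
  have h2 : ∀ a : ℕ × ℕ, ∑ᶠ b, g (e (a, b)) = A' a.1 (A a.2 (x (m - (a.1 + a.2 : ℕ)) v)) := by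
    intro a
    have hga : (Function.support fun b => g (e (a, b))).Finite :=
      hge.preimage (Prod.mk_right_injective a).injOn
    have h3 : ∀ n, ∑ b ∈ Finset.HasAntidiagonal.antidiagonal n, g (e (a, b)) =
        A' a.1 (A a.2 (x (m - (a.1 + a.2 : ℕ) + (n : ℕ)) (if n = 0 then v else 0))) := by
      intro n
      have h4 := congrArg (fun f : Module.End ℂ V => f v) (hBB n)
      simp only [LinearMap.sum_apply, Module.End.mul_apply] at h4
      have h5 : (if n = 0 then v else 0) = (if n = 0 then (1 : Module.End ℂ V) else 0) v := by
        split_ifs <;> simp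
      rw [h5, ← h4, map_sum, map_sum, map_sum]
      refine Finset.sum_congr rfl fun b hb => ?_
      rw [Finset.HasAntidiagonal.mem_antidiagonal] at hb
      simp only [g, e, Equiv.coe_fn_mk, hb]
    rw [finsum_eq_finsum_antidiagonal _ hga, finsum_eq_single _ 0]
    · rw [h3]
      simp
    · intro n hn
      rw [h3, if_neg hn]
      simp
  rw [finsum_congr h2, finsum_eq_finsum_antidiagonal, finsum_eq_single _ 0]
  · have := congrArg (fun f : Module.End ℂ V => f (x m v)) (hA 0)
    simpa using this
  · intro n hn
    have h3 := congrArg (fun f : Module.End ℂ V => f (x (m - n) v)) (hA n)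
    simp only [LinearMap.sum_apply, Module.End.mul_apply, if_neg hn, LinearMap.zero_apply] at h3
    rw [← h3]
    refine Finset.sum_congr rfl fun b hb => ?_
    rw [Finset.HasAntidiagonal.mem_antidiagonal] at hb
    rw [hb]
  · obtain ⟨M, hM⟩ := hx v
    refine (Set.Finite.prod (Set.finite_Iio (m - M).toNat)
      (Set.finite_Iio (m - M).toNat)).subset ?_
    rintro ⟨p, q⟩ hpq
    have h3 : ¬ (m - (p + q : ℕ) ≤ M) := by
      intro h3
      exact hpq (by simp only [hM _ h3, map_zero])
    simp only [Set.mem_prod, Set.mem_Iio]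
    push_cast at h3
    omega

theorem finsum_eq_finsum_comp_of_injective {α β M : Type*} [AddCommMonoid M] {ι : α → β}
    (hι : Function.Injective ι) (F : β → M) (hF : ∀ b, b ∉ Set.range ι → F b = 0) :
    ∑ᶠ b, F b = ∑ᶠ a, F (ι a) := by
  rw [← finsum_mem_range hι, finsum_mem_def, Set.indicator_eq_self.2]
  intro b hb
  by_contra h
  exact hb (hF b h)

/-- Term by term `a` fails to commute, but the error consists of two copies of one family with
opposite signs, the second displaced along `ι`. They cancel after summation; `ι` will be a shift of
`p` or of `r`. -/
theorem apply_dress_of_shift (hx : LocallyBounded x) (hB : LocallyFinite B)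
    (a : Module.End ℂ V) (c : ℂ) (m m' : ℤ) (v : V) (ι : ℕ × ℕ → ℕ × ℕ)
    (hι : Function.Injective ι) (S : ℕ × ℕ → V) (hS : ∀ pr, S (ι pr) = dressTerm A B x m' v pr)
    (hS' : ∀ pr, pr ∉ Set.range ι → S pr = 0)
    (h : ∀ pr, a (dressTerm A B x m v pr) =
      dressTerm A B x m (a v) pr + (-c • dressTerm A B x m' v pr + c • S pr)) :
    a (dress A hx hB m v) = dress A hx hB m (a v) := by
  have h0 := dressTerm_support_finite (A := A) hx hB m v
  have h1 := dressTerm_support_finite (A := A) hx hB m (a v)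
  have h2 := dressTerm_support_finite (A := A) hx hB m' v
  have h3 : (Function.support S).Finite := by
    refine (h2.image ι).subset fun pr hpr => ?_
    by_contra hne
    by_cases hr : pr ∈ Set.range ι
    · obtain ⟨pr, rfl⟩ := hr
      exact hne ⟨pr, by rwa [Function.mem_support, ← hS], rfl⟩
    · exact hpr (hS' pr hr)
  have h4 : (Function.support fun pr => -c • dressTerm A B x m' v pr).Finite :=
    h2.subset (Function.support_const_smul_subset _ _)
  have h5 : (Function.support fun pr => c • S pr).Finite :=
    h3.subset (Function.support_const_smul_subset _ _)
  rw [dress_apply, dress_apply, ← LinearMap.toAddMonoidHom_coe, a.toAddMonoidHom.map_finsum h0]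
  simp only [LinearMap.toAddMonoidHom_coe, h]
  rw [finsum_add_distrib h1 ((h4.union h5).subset (Function.support_add _ _)),
    finsum_add_distrib h4 h5, ← smul_finsum' _ h2, ← smul_finsum' _ h3,
    finsum_eq_finsum_comp_of_injective hι S hS', finsum_congr hS, neg_smul, neg_add_cancel,
    add_zero]

/-- An operator whose commutators with `A(z)` and `x(z)` cancel, and that commutes with `B(z)`,
commutes with `A(z) x(z) B(z⁻¹)`. -/
theorem commute_dress_of_left (hx : LocallyBounded x) (hB : LocallyFinite B)
    (a : Module.End ℂ V) (c : ℂ) (n : ℕ)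
    (haA : ∀ p, a * A p - A p * a = if n ≤ p then c • A (p - n) else 0)
    (hax : ∀ m, a * x m - x m * a = -c • x (m - n)) (haB : ∀ r, Commute a (B r)) (m : ℤ) :
    Commute a (dress A hx hB m) := by
  ext v
  rw [Module.End.mul_apply, Module.End.mul_apply]
  refine apply_dress_of_shift hx hB a c m (m - n) v (fun pr => (pr.1 + n, pr.2)) ?_
    (fun pr => if n ≤ pr.1 then A (pr.1 - n) (x (m - pr.1 + pr.2) (B pr.2 v)) else 0) ?_ ?_ ?_
  · rintro ⟨p, r⟩ ⟨p', r'⟩ h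
    simp only [Prod.mk.injEq] at h
    ext <;> simp only <;> omega
  · rintro ⟨p, r⟩
    simp only [dressTerm, Nat.le_add_left, if_true, Nat.add_sub_cancel]
    congr 3
    push_cast
    ring
  · rintro ⟨p, r⟩ hpr
    refine if_neg fun hle => hpr ⟨(p - n, r), ?_⟩
    simp only [Prod.mk.injEq, and_true] at hle ⊢
    omega
  · rintro ⟨p, r⟩
    have h1 : a * (A p * (x (m - p + r) * B r)) = A p * (x (m - p + r) * (B r * a)) +
        (A p * ((a * x (m - p + r) - x (m - p + r) * a) * B r) +
          (a * A p - A p * a) * (x (m - p + r) * B r)) := by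
      rw [← (haB r).eq]
      noncomm_ring
    rw [haA, hax] at h1
    have h2 := congrArg (fun f : Module.End ℂ V => f v) h1
    simp only [Module.End.mul_apply, LinearMap.add_apply, LinearMap.smul_apply, map_smul] at h2
    simp only [dressTerm]
    rw [h2]
    congr 2
    · congr 4
      ring
    · split_ifs <;> simp

/-- An operator whose commutators with `x(z)` and `B(z)` cancel, and that commutes with `A(z)`,
commutes with `A(z) x(z) B(z⁻¹)`. -/
theorem commute_dress_of_right (hx : LocallyBounded x) (hB : LocallyFinite B)
    (a : Module.End ℂ V) (c : ℂ) (n : ℕ)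
    (haB : ∀ r, a * B r - B r * a = if n ≤ r then c • B (r - n) else 0)
    (hax : ∀ m, a * x m - x m * a = -c • x (m + n)) (haA : ∀ p, Commute a (A p)) (m : ℤ) :
    Commute a (dress A hx hB m) := by
  ext v
  rw [Module.End.mul_apply, Module.End.mul_apply]
  refine apply_dress_of_shift hx hB a c m (m + n) v (fun pr => (pr.1, pr.2 + n)) ?_
    (fun pr => if n ≤ pr.2 then A pr.1 (x (m - pr.1 + pr.2) (B (pr.2 - n) v)) else 0) ?_ ?_ ?_
  · rintro ⟨p, r⟩ ⟨p', r'⟩ h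
    simp only [Prod.mk.injEq] at h
    ext <;> simp only <;> omega
  · rintro ⟨p, r⟩
    simp only [dressTerm, Nat.le_add_left, if_true, Nat.add_sub_cancel]
    congr 3
    push_cast
    ring
  · rintro ⟨p, r⟩ hpr
    refine if_neg fun hle => hpr ⟨(p, r - n), ?_⟩
    simp only [Prod.mk.injEq, true_and] at hle ⊢
    omega
  · rintro ⟨p, r⟩
    have h1 : a * (A p * (x (m - p + r) * B r)) = A p * (x (m - p + r) * (B r * a)) +
        (A p * ((a * x (m - p + r) - x (m - p + r) * a) * B r) +
          A p * (x (m - p + r) * (a * B r - B r * a))) := by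
      rw [← mul_assoc, (haA p).eq]
      noncomm_ring
    rw [haB, hax] at h1
    have h2 := congrArg (fun f : Module.End ℂ V => f v) h1
    simp only [Module.End.mul_apply, LinearMap.add_apply, LinearMap.smul_apply, map_smul] at h2
    simp only [dressTerm]
    rw [h2]
    congr 2
    · congr 4
      ring
    · split_ifs <;> simp

end Dressing

/-! ### Degrees of operators under the grading -/

section Homogeneous

variable {V : Type*} [AddCommGroup V] [Module ℂ V]

theorem apply_mem_eigenspace {d f : Module.End ℂ V} {n a : ℂ} (h : d * f - f * d = n • f) {v : V}
    (hv : v ∈ Module.End.eigenspace d a) : f v ∈ Module.End.eigenspace d (a + n) := by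
  rw [Module.End.mem_eigenspace_iff] at hv ⊢
  have h1 := congrArg (fun g : Module.End ℂ V => g v) h
  simp only [LinearMap.sub_apply, Module.End.mul_apply, hv, map_smul, LinearMap.smul_apply] at h1
  rw [add_smul, ← h1]
  abel

/-- A series whose `n`-th coefficient has degree `n` for the derivation `[d, ·]`. -/
def HomogeneousSeries {R : Type*} [Ring R] [Algebra ℂ R] (d : R) (F : PowerSeries R) : Prop :=
  ∀ n, d * PowerSeries.coeff n F - PowerSeries.coeff n F * d = (n : ℂ) • PowerSeries.coeff n F

variable {R : Type*} [Ring R] [Algebra ℂ R] {d : R}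

theorem HomogeneousSeries.mul {F G : PowerSeries R} (hF : HomogeneousSeries d F)
    (hG : HomogeneousSeries d G) : HomogeneousSeries d (F * G) := by
  intro n
  rw [PowerSeries.coeff_mul, Finset.mul_sum, Finset.sum_mul, ← Finset.sum_sub_distrib,
    Finset.smul_sum]
  refine Finset.sum_congr rfl fun p hp => ?_
  rw [Finset.HasAntidiagonal.mem_antidiagonal] at hp
  have h1 : d * (PowerSeries.coeff p.1 F * PowerSeries.coeff p.2 G) -
      PowerSeries.coeff p.1 F * PowerSeries.coeff p.2 G * d =
      (d * PowerSeries.coeff p.1 F - PowerSeries.coeff p.1 F * d) * PowerSeries.coeff p.2 G +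
      PowerSeries.coeff p.1 F * (d * PowerSeries.coeff p.2 G - PowerSeries.coeff p.2 G * d) := by
    noncomm_ring
  rw [h1, hF, hG, smul_mul_assoc, mul_smul_comm, ← add_smul, ← hp]
  push_cast
  rfl

theorem HomogeneousSeries.pow {F : PowerSeries R} (hF : HomogeneousSeries d F) (j : ℕ) :
    HomogeneousSeries d (F ^ j) := by
  induction j with
  | zero =>
    intro n
    rw [pow_zero, PowerSeries.coeff_one]
    split_ifs with h
    · simp [h]
    · simp
  | succ j ih =>
    rw [pow_succ]
    exact ih.mul hF

theorem homogeneousSeries_psExp_modeSeries {c : ℕ+ → ℂ} {b : ℕ+ → R}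
    (h : ∀ n : ℕ+, d * b n - b n * d = ((n : ℕ) : ℂ) • b n) :
    HomogeneousSeries d (psExp (modeSeries c b)) := by
  have h1 : HomogeneousSeries d (modeSeries c b) := by
    intro n
    rcases Nat.eq_zero_or_pos n with rfl | hn
    · simp
    · lift n to ℕ+ using hn
      rw [coeff_modeSeries, mul_smul_comm, smul_mul_assoc, ← smul_sub, h, smul_comm]
  intro n
  rw [psExp, PowerSeries.coeff_mk, Finset.mul_sum, Finset.sum_mul, ← Finset.sum_sub_distrib,
    Finset.smul_sum]
  refine Finset.sum_congr rfl fun j _ => ?_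
  rw [mul_smul_comm, smul_mul_assoc, ← smul_sub, h1.pow j, smul_comm]

end Homogeneous

/-! ### Inverse exponential operators -/

section Inverse

variable (ħ : ℂ) (k : ℚ) {W : Type*} [AddCommGroup W] [Module ℂ W]

theorem Eminus_neg_mul (ε : ℤˣ) (b : ℕ+ → Module.End ℂ W) :
    Eminus ħ k ε (-1) b * Eminus ħ k ε 1 b = 1 := by
  rw [Eminus, Eminus, ← psExp_neg_mul_psExp (coeff_zero_modeSeries _ b), ← modeSeries_neg]
  congr 3
  ext n
  simp

theorem Eplus_mul_neg (ε : ℤˣ) (b : ℕ+ → Module.End ℂ W) :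
    Eplus ħ k ε 1 b * Eplus ħ k ε (-1) b = 1 := by
  rw [Eplus, Eplus, ← psExp_mul_psExp_neg (coeff_zero_modeSeries _ b), ← modeSeries_neg]
  congr 3
  ext n
  simp

end Inverse

/-! ### The defining relations at level `k` and bounded degrees -/

section Action

variable {X : SimpleType} {ħ : ℂ} {k : ℚ}
variable {V : Type*} [AddCommGroup V] [Module ℂ V] [Module (Uq X ħ) V] [IsScalarTower ℂ (Uq X ħ) V]

variable (X ħ V) in
/-- The representation of the free algebra on a module. -/
def freeAct : Free X →ₐ[ℂ] Module.End ℂ V := (Algebra.lsmul ℂ ℂ V).comp (Uq.mk X ħ)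

theorem freeAct_gen (g : Gen X) : freeAct X ħ V (gen g) = act ħ V g := rfl

theorem freeAct_rel {a b : Free X} (h : Rel X ħ a b) : freeAct X ħ V a = freeAct X ħ V b := by
  have : Uq.mk X ħ a = Uq.mk X ħ b := RingQuot.mkAlgHom_rel ℂ h
  rw [freeAct, AlgHom.comp_apply, AlgHom.comp_apply, this]

theorem deg_a_commutator (i : X.Idx) (n : NZ) :
    act ħ V (Gen.deg (X := X)) * act ħ V (Gen.a i n) -
      act ħ V (Gen.a i n) * act ħ V (Gen.deg (X := X)) =
      (n.1 : ℂ) • act ħ V (Gen.a i n) := by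
  simpa only [map_sub, map_mul, map_smul, freeAct_gen] using
    freeAct_rel (V := V) (Rel.deg_a (ħ := ħ) i n)

theorem deg_x_commutator (ε : ℤˣ) (i : X.Idx) (n : ℤ) :
    act ħ V (Gen.deg (X := X)) * act ħ V (Gen.x ε i n) -
      act ħ V (Gen.x ε i n) * act ħ V (Gen.deg (X := X)) =
      (n : ℂ) • act ħ V (Gen.x ε i n) := by
  simpa only [map_sub, map_mul, map_smul, freeAct_gen] using
    freeAct_rel (V := V) (Rel.deg_x (ħ := ħ) ε i n)

variable (hV : InCategory X ħ k V)
include hV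

theorem act_gamma : act ħ V (Gen.gamma (X := X)) = qpow ħ (k / 2) • 1 :=
  LinearMap.ext fun v => hV.level v

theorem act_gammaInv : act ħ V (Gen.gammaInv (X := X)) = qpow ħ (-(k / 2)) • 1 := by
  have h := freeAct_rel (V := V) (Rel.gamma_inv (ħ := ħ) (X := X))
  rw [map_mul, map_one, freeAct_gen, freeAct_gen, act_gamma hV, smul_mul_assoc, one_mul] at h
  rw [qpow_neg, ← h, smul_smul, inv_mul_cancel₀ (qpow_ne_zero _ _), one_smul]

theorem freeAct_gammaHalfPow (r : ℤ) :
    freeAct X ħ V (gammaHalfPow X r) = qpow ħ (k * r / 2) • 1 := by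
  rw [gammaHalfPow]
  split_ifs with hr
  · lift r to ℕ using hr
    rw [map_pow, freeAct_gen, act_gamma hV, smul_pow, one_pow, ← qpow_nat_mul]
    congr 2
    simp
    ring
  · obtain ⟨n, rfl⟩ : ∃ n : ℕ, r = -n := ⟨(-r).toNat, by omega⟩
    rw [map_pow, freeAct_gen, act_gammaInv hV, smul_pow, one_pow, ← qpow_nat_mul]
    congr 2
    simp
    ring

theorem a_a_commutator (i j : X.Idx) (m n : NZ) :
    act ħ V (Gen.a i m) * act ħ V (Gen.a j n) - act ħ V (Gen.a j n) * act ħ V (Gen.a i m) =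
      if m.1 = -n.1 then
        (qnum ħ (X.form i j * m.1) / (m.1 : ℂ) * qnum ħ (k * m.1)) • (1 : Module.End ℂ V)
      else 0 := by
  have h := freeAct_rel (V := V) (Rel.a_a (ħ := ħ) i j m n)
  rw [map_sub, map_mul, map_mul, freeAct_gen, freeAct_gen] at h
  rw [h]
  split_ifs
  · rw [map_smul, map_sub, freeAct_gammaHalfPow hV, freeAct_gammaHalfPow hV, ← sub_smul, smul_smul]
    congr 1
    rw [show qnum ħ (k * m.1) = (qpow ħ (k * m.1) - qpow ħ (-(k * m.1))) /
      (qpow ħ 1 - qpow ħ (-1)) from rfl]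
    push_cast
    rw [show k * (2 * (m.1 : ℚ)) / 2 = k * m.1 by ring,
      show k * -(2 * (m.1 : ℚ)) / 2 = -(k * m.1) by ring]
    ring
  · exact map_zero _

theorem a_x_commutator (ε : ℤˣ) (i j : X.Idx) (m : NZ) (n : ℤ) :
    act ħ V (Gen.a i m) * act ħ V (Gen.x ε j n) - act ħ V (Gen.x ε j n) * act ħ V (Gen.a i m) =
      (((ε : ℤ) : ℂ) * (qnum ħ (X.form i j * m.1) / (m.1 : ℂ)) *
        qpow ħ (-(((ε : ℤ) : ℚ) * k * |(m.1 : ℚ)| / 2))) • act ħ V (Gen.x ε j (m.1 + n)) := by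
  have h := freeAct_rel (V := V) (Rel.a_x (ħ := ħ) ε i j m n)
  rw [map_sub, map_mul, map_mul, freeAct_gen, freeAct_gen] at h
  rw [h, map_smul, map_mul, freeAct_gammaHalfPow hV, freeAct_gen, smul_mul_assoc, one_mul,
    smul_smul]
  congr 3
  push_cast
  ring

theorem annih_annih_commute (i j : X.Idx) (m n : ℕ+) :
    Commute (actAnnih ħ V i m) (actAnnih ħ V j n) := by
  have h := a_a_commutator hV i j (NZ.pos m) (NZ.pos n)
  have := m.pos
  have := n.pos
  rw [if_neg (by simp only [NZ.pos]; omega), sub_eq_zero] at h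
  exact h

theorem create_create_commute (i j : X.Idx) (m n : ℕ+) :
    Commute (actCreate ħ V i m) (actCreate ħ V j n) := by
  have h := a_a_commutator hV i j (NZ.neg m) (NZ.neg n)
  have := m.pos
  have := n.pos
  rw [if_neg (by simp only [NZ.neg]; omega), sub_eq_zero] at h
  exact h

theorem annih_create_commutator (i j : X.Idx) (n m : ℕ+) :
    actAnnih ħ V i n * actCreate ħ V j m - actCreate ħ V j m * actAnnih ħ V i n =
      if m = n then
        (qnum ħ (X.form i j * (n : ℕ)) * qnum ħ ((n : ℕ) * k) / ((n : ℕ) : ℂ)) •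
          (1 : Module.End ℂ V)
      else 0 := by
  rw [actAnnih, actCreate, a_a_commutator hV]
  simp only [NZ.pos, NZ.neg, neg_neg, Nat.cast_inj, PNat.coe_inj, eq_comm (a := m)]
  split_ifs
  · congr 1
    push_cast
    rw [mul_comm k]
    ring
  · rfl

theorem create_annih_commutator (j i : X.Idx) (n m : ℕ+) :
    actCreate ħ V j n * actAnnih ħ V i m - actAnnih ħ V i m * actCreate ħ V j n =
      if m = n then
        (-(qnum ħ (X.form j i * (n : ℕ)) * qnum ħ ((n : ℕ) * k) / ((n : ℕ) : ℂ))) •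
          (1 : Module.End ℂ V)
      else 0 := by
  rw [actAnnih, actCreate, a_a_commutator hV]
  simp only [NZ.pos, NZ.neg, neg_inj, Nat.cast_inj, PNat.coe_inj, eq_comm (a := m)]
  split_ifs
  · congr 1
    push_cast
    rw [mul_neg, mul_neg, qnum_neg, qnum_neg, mul_comm k]
    ring
  · rfl

theorem annih_x_commutator (ε : ℤˣ) (j i : X.Idx) (n : ℕ+) (m : ℤ) :
    actAnnih ħ V j n * xCoeff ħ V ε i m - xCoeff ħ V ε i m * actAnnih ħ V j n =
      (((ε : ℤ) : ℂ) * (qnum ħ (X.form j i * (n : ℕ)) / ((n : ℕ) : ℂ)) *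
        qpow ħ (-(((ε : ℤ) : ℚ) * k * (n : ℕ) / 2))) • xCoeff ħ V ε i (m - (n : ℕ)) := by
  rw [actAnnih, xCoeff, a_x_commutator hV, xCoeff]
  simp only [NZ.pos]
  rw [show (((n : ℕ) : ℤ) + (-m - 1)) = -(m - (n : ℕ)) - 1 by ring]
  push_cast
  rw [abs_of_nonneg (by positivity)]

theorem create_x_commutator (ε : ℤˣ) (j i : X.Idx) (n : ℕ+) (m : ℤ) :
    actCreate ħ V j n * xCoeff ħ V ε i m - xCoeff ħ V ε i m * actCreate ħ V j n =
      (((ε : ℤ) : ℂ) * (qnum ħ (X.form j i * (n : ℕ)) / ((n : ℕ) : ℂ)) *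
        qpow ħ (-(((ε : ℤ) : ℚ) * k * (n : ℕ) / 2))) • xCoeff ħ V ε i (m + (n : ℕ)) := by
  rw [actCreate, xCoeff, a_x_commutator hV, xCoeff]
  simp only [NZ.neg]
  rw [show (-((n : ℕ) : ℤ) + (-m - 1)) = -(m + (n : ℕ)) - 1 by ring]
  push_cast
  rw [abs_neg, abs_of_nonneg (by positivity), mul_neg, qnum_neg, neg_div_neg_eq]

/-- Degrees are bounded above on every vector. -/
theorem exists_forall_apply_eq_zero (v : V) :
    ∃ n₀ : ℕ, ∀ (n : ℕ) (f : Module.End ℂ V), n₀ < n →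
      act ħ V (Gen.deg (X := X)) * f - f * act ħ V (Gen.deg (X := X)) = (n : ℂ) • f →
      f v = 0 := by
  have hv : v ∈ ⨆ a, degreeSpace X ħ V a := by rw [hV.graded]; trivial
  refine Submodule.iSup_induction _ (motive := fun v => ∃ n₀ : ℕ, ∀ (n : ℕ)
    (f : Module.End ℂ V), n₀ < n →
      act ħ V (Gen.deg (X := X)) * f - f * act ħ V (Gen.deg (X := X)) = (n : ℂ) • f →
      f v = 0) hv ?_ ?_ ?_
  · intro a v hv
    obtain ⟨n₀, h⟩ := hV.bounded a
    refine ⟨n₀, fun n f hn hf => ?_⟩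
    have h1 := apply_mem_eigenspace hf hv
    rw [← degreeSpace, h n hn] at h1
    exact h1
  · exact ⟨0, fun n f _ _ => map_zero f⟩
  · rintro v w ⟨n₁, h₁⟩ ⟨n₂, h₂⟩
    refine ⟨max n₁ n₂, fun n f hn hf => ?_⟩
    rw [map_add, h₁ n f (by omega) hf, h₂ n f (by omega) hf, add_zero]

theorem locallyBounded_xCoeff (ε : ℤˣ) (i : X.Idx) : LocallyBounded (xCoeff ħ V ε i) := by
  intro v
  obtain ⟨n₀, h⟩ := exists_forall_apply_eq_zero hV v
  -- The coefficient of `z^m` is the mode `-m - 1`, whose degree then exceeds `n₀`.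
  refine ⟨-n₀ - 2, fun m hm => ?_⟩
  refine h (-m - 1).toNat _ (by omega) ?_
  rw [xCoeff, deg_x_commutator]
  congr 1
  exact_mod_cast (Int.toNat_of_nonneg (by omega : 0 ≤ -m - 1)).symm

theorem locallyFinite_Eplus (ε σ : ℤˣ) (i : X.Idx) :
    LocallyFinite fun r => PowerSeries.coeff r (Eplus ħ k ε σ (actAnnih ħ V i)) := by
  intro v
  obtain ⟨n₀, h⟩ := exists_forall_apply_eq_zero hV v
  refine ⟨n₀ + 1, fun r hr => h r _ (by omega) ?_⟩
  exact homogeneousSeries_psExp_modeSeries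
    (fun n => by simpa [NZ.pos, actAnnih] using deg_a_commutator (V := V) i (NZ.pos n)) r

end Action

/-! ### Dual annihilators and the isomorphism with `K(k) ⊗ Ω_V` -/

section Heisenberg

variable {X : SimpleType} {ħ : ℂ} {k : ℚ}
variable {V : Type*} [AddCommGroup V] [Module ℂ V] [Module (Uq X ħ) V] [IsScalarTower ℂ (Uq X ħ) V]

variable (X ħ k) in
/-- The matrix `[a_i(n), a_j(-n)] = [(α_i|α_j) n] [n k] / n` at level `k`. -/
def heisenbergMatrix (n : ℕ+) : Matrix X.Idx X.Idx ℂ :=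
  Matrix.of fun i j => qnum ħ (X.form i j * (n : ℕ)) * qnum ħ ((n : ℕ) * k) / ((n : ℕ) : ℂ)

variable (k) in
theorem isUnit_det_heisenbergMatrix (hq : ∀ n : ℕ, 0 < n → Complex.exp ħ ^ n ≠ 1) (hk : k ≠ 0)
    (n : ℕ+) : IsUnit (heisenbergMatrix X ħ k n).det := by
  have hn : ((n : ℕ) : ℂ) ≠ 0 := by exact_mod_cast n.ne_zero
  have hn' : ((n : ℕ) : ℚ) ≠ 0 := by exact_mod_cast n.ne_zero
  have hkn := qnum_ne_zero hq (mul_ne_zero hn' hk)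
  rw [isUnit_iff_ne_zero]
  intro h
  obtain ⟨v, hv, hv0⟩ := Matrix.exists_mulVec_eq_zero_iff.2 h
  refine hv (form_kernel hq X n fun i => ?_)
  have h1 := congrFun hv0 i
  simp only [Matrix.mulVec, dotProduct, heisenbergMatrix, Matrix.of_apply, Pi.zero_apply] at h1
  refine mul_left_cancel₀ (div_ne_zero hkn hn) ?_
  rw [mul_zero, Finset.mul_sum, ← h1]
  exact Finset.sum_congr rfl fun j _ => by ring

variable (ħ k V) in
/-- The combinations of the `a_j(n)` dual to the `a_i(-n)`. -/
def dualAnnih (p : X.Idx × ℕ+) : Module.End ℂ V :=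
  ∑ j, (heisenbergMatrix X ħ k p.2)⁻¹ p.1 j • actAnnih ħ V j p.2

theorem actAnnih_eq_sum_dualAnnih (hq : ∀ n : ℕ, 0 < n → Complex.exp ħ ^ n ≠ 1) (hk : k ≠ 0)
    (i : X.Idx) (n : ℕ+) :
    actAnnih ħ V i n = ∑ j, heisenbergMatrix X ħ k n i j • dualAnnih ħ k V (j, n) := by
  simp only [dualAnnih, Finset.smul_sum, smul_smul]
  rw [Finset.sum_comm]
  simp only [← Finset.sum_smul, ← Matrix.mul_apply,
    Matrix.mul_nonsing_inv _ (isUnit_det_heisenbergMatrix k hq hk n), Matrix.one_apply, ite_smul,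
    one_smul, zero_smul, Finset.sum_ite_eq, Finset.mem_univ, if_true]

variable (X ħ V) in
/-- The action of `K(k)`, as an algebra of polynomials, on a module. -/
def fockAct : Fock X →ₐ[ℂ] Module.End ℂ V := (Algebra.lsmul ℂ ℂ V).comp (incl ħ)

theorem fockAct_X (p : X.Idx × ℕ+) :
    fockAct X ħ V (MvPolynomial.X p) = actCreate ħ V p.1 p.2 := by
  rw [fockAct, AlgHom.comp_apply, incl_X]
  rfl

/-- All coefficients in the exponents are nonzero, so fixing `v` forces every mode to kill it; the
single choice `ε = σ = 1` already suffices for this direction. -/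
theorem mem_vacuum_iff (hq : ∀ n : ℕ, 0 < n → Complex.exp ħ ^ n ≠ 1) (hk : k ≠ 0) {v : V} :
    v ∈ vacuum X ħ k V ↔ ∀ (i : X.Idx) (n : ℕ+), actAnnih ħ V i n v = 0 := by
  refine ⟨fun h i => ?_, fun h ε σ i => coeff_psExp_apply_of_annihilated _ (h i)⟩
  refine annihilated_of_coeff_psExp_apply (fun n => ?_) (h 1 1 i)
  have hn : ((n : ℕ) : ℚ) ≠ 0 := by exact_mod_cast n.ne_zero
  simpa using ⟨qpow_ne_zero _ _, qnum_ne_zero hq (mul_ne_zero hk hn)⟩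

variable (hV : InCategory X ħ k V)
include hV

theorem dualAnnih_create_commutator (hq : ∀ n : ℕ, 0 < n → Complex.exp ħ ^ n ≠ 1) (hk : k ≠ 0)
    (p r : X.Idx × ℕ+) :
    dualAnnih ħ k V p * fockAct X ħ V (MvPolynomial.X r) -
      fockAct X ħ V (MvPolynomial.X r) * dualAnnih ħ k V p = if p = r then 1 else 0 := by
  obtain ⟨i, n⟩ := p
  obtain ⟨j, m⟩ := r
  rw [fockAct_X, dualAnnih, Finset.sum_mul, Finset.mul_sum, ← Finset.sum_sub_distrib]
  simp only [smul_mul_assoc, mul_smul_comm, ← smul_sub, annih_create_commutator hV]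
  by_cases hmn : m = n
  · subst hmn
    have h1 := congrFun (congrFun
      (Matrix.nonsing_inv_mul _ (isUnit_det_heisenbergMatrix (X := X) k hq hk m)) i) j
    rw [Matrix.mul_apply, Matrix.one_apply] at h1
    simp only [if_true, smul_smul, ← Finset.sum_smul]
    change (∑ x, (heisenbergMatrix X ħ k m)⁻¹ i x * heisenbergMatrix X ħ k m x j) • _ = _
    rw [h1]
    simp only [Prod.mk.injEq, and_true, ite_smul, one_smul, zero_smul]
  · simp [hmn, Ne.symm hmn]

theorem dualAnnih_commute (p r : X.Idx × ℕ+) :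
    Commute (dualAnnih ħ k V p) (dualAnnih ħ k V r) :=
  Commute.sum_left _ _ _ fun i _ => Commute.sum_right _ _ _ fun j _ =>
    ((annih_annih_commute hV i j p.2 r.2).smul_right _).smul_left _

omit hV in
theorem deg_dualAnnih_commutator (p : X.Idx × ℕ+) :
    act ħ V (Gen.deg (X := X)) * dualAnnih ħ k V p - dualAnnih ħ k V p * act ħ V (Gen.deg (X := X)) =
      ((p.2 : ℕ) : ℂ) • dualAnnih ħ k V p := by
  rw [dualAnnih, Finset.mul_sum, Finset.sum_mul, ← Finset.sum_sub_distrib, Finset.smul_sum]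
  refine Finset.sum_congr rfl fun j _ => ?_
  have h := deg_a_commutator (V := V) (ħ := ħ) j (NZ.pos p.2)
  rw [mul_smul_comm, smul_mul_assoc, ← smul_sub, actAnnih, h, smul_comm]
  simp [NZ.pos]

/-- The `N`-th power raises degrees by `N * p.2`, eventually beyond the bound attached to `v`. -/
theorem dualAnnih_locally_nilpotent (p : X.Idx × ℕ+) (v : V) :
    ∃ N : ℕ, (dualAnnih ħ k V p ^ N) v = 0 := by
  obtain ⟨n₀, h⟩ := exists_forall_apply_eq_zero hV v
  have hp := p.2.pos
  refine ⟨n₀ + 1, h ((n₀ + 1) * p.2) _ (by nlinarith) ?_⟩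
  suffices H : ∀ N : ℕ, act ħ V (Gen.deg (X := X)) * dualAnnih ħ k V p ^ N -
      dualAnnih ħ k V p ^ N * act ħ V (Gen.deg (X := X)) =
      ((N * p.2 : ℕ) : ℂ) • dualAnnih ħ k V p ^ N from H _
  intro N
  induction N with
  | zero => simp
  | succ N ih =>
    set d := act ħ V (Gen.deg (X := X))
    have h1 : d * dualAnnih ħ k V p ^ (N + 1) - dualAnnih ħ k V p ^ (N + 1) * d =
        (d * dualAnnih ħ k V p ^ N - dualAnnih ħ k V p ^ N * d) * dualAnnih ħ k V p +
        dualAnnih ħ k V p ^ N * (d * dualAnnih ħ k V p - dualAnnih ħ k V p * d) := by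
      rw [pow_succ]
      noncomm_ring
    rw [h1, ih, deg_dualAnnih_commutator, smul_mul_assoc, mul_smul_comm, ← pow_succ, ← add_smul]
    congr 1
    push_cast
    ring

/-- The degree bound attached to `v` limits the mode number, and there are finitely many simple
roots. -/
theorem dualAnnih_finite (v : V) : {p : X.Idx × ℕ+ | dualAnnih ħ k V p v ≠ 0}.Finite := by
  obtain ⟨n₀, h⟩ := exists_forall_apply_eq_zero hV v
  refine (Set.Finite.prod Set.finite_univ (Set.finite_Iic n₀.succPNat)).subset fun p hp => ?_
  simp only [Set.mem_prod, Set.mem_univ, true_and, Set.mem_Iic, ← PNat.coe_le_coe,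
    Nat.succPNat_coe]
  by_contra hlt
  exact hp (h p.2 _ (by omega) (deg_dualAnnih_commutator p))

/-- `K(k) ⊗ Ω_V ≅ V`. -/
theorem fockMap_bijective (hq : ∀ n : ℕ, 0 < n → Complex.exp ħ ^ n ≠ 1) (hk : k ≠ 0) :
    Function.Bijective (fockMap (fockAct X ħ V) (vacuum X ħ k V)) := by
  constructor
  · refine fockMap_injective (D := dualAnnih ħ k V) (fun w hw p => ?_)
      (dualAnnih_create_commutator hV hq hk)
    rw [mem_vacuum_iff hq hk] at hw
    simp [dualAnnih, LinearMap.sum_apply, hw]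
  · refine fockMap_surjective (D := dualAnnih ħ k V) (fun w hw => ?_)
      (dualAnnih_create_commutator hV hq hk) (dualAnnih_commute hV)
      (dualAnnih_locally_nilpotent hV) (dualAnnih_finite hV)
    rw [mem_vacuum_iff hq hk]
    intro i n
    rw [actAnnih_eq_sum_dualAnnih hq hk]
    simp [LinearMap.sum_apply, hw]

end Heisenberg

/-! ### Z-operators commute with the Heisenberg algebra -/

section ZOperators

variable {X : SimpleType} {ħ : ℂ} {k : ℚ}
variable {V : Type*} [AddCommGroup V] [Module ℂ V] [Module (Uq X ħ) V] [IsScalarTower ℂ (Uq X ħ) V]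
variable (hV : InCategory X ħ k V)

/-- The coefficient of `z^m` in `Z^ε(α_i, z)`, as an operator on the module. -/
def zOp (ε : ℤˣ) (i : X.Idx) (m : ℤ) : Module.End ℂ V :=
  dress (fun p => PowerSeries.coeff p (Eminus ħ k ε 1 (actCreate ħ V i)))
    (locallyBounded_xCoeff hV ε i) (locallyFinite_Eplus hV ε 1 i) m

/-- The factor `[kn]` in the bracket of `a_j(n)` with `a_i(-n)` cancels the denominator in the
exponent of `E_-`, leaving exactly the opposite of the coefficient in the bracket with `x_i^ε(z)`;
`E_+` commutes with `a_j(n)`. -/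
theorem annih_commute_zOp (hq : ∀ n : ℕ, 0 < n → Complex.exp ħ ^ n ≠ 1) (hk : k ≠ 0)
    (ε : ℤˣ) (i j : X.Idx) (n : ℕ+) (m : ℤ) : Commute (actAnnih ħ V j n) (zOp hV ε i m) := by
  have hn : ((n : ℕ) : ℚ) ≠ 0 := by exact_mod_cast n.ne_zero
  have hkn := qnum_ne_zero hq (mul_ne_zero hk hn)
  refine commute_dress_of_left _ _ _ _ n
    (commutator_coeff_psExp _ _ _ n _ (annih_create_commutator hV j i n)) (fun m => ?_)
    (fun r => commute_coeff_psExp _ _ _ (annih_annih_commute hV j i n) r) m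
  rw [annih_x_commutator hV]
  congr 1
  rw [mul_comm ((n : ℕ) : ℚ) k, Units.val_one, Int.cast_one, mul_one]
  generalize qnum ħ (k * (n : ℕ)) = a at hkn
  field_simp

/-- Mirror case: here `E_+` supplies the cancellation and `E_-` commutes. -/
theorem create_commute_zOp (hq : ∀ n : ℕ, 0 < n → Complex.exp ħ ^ n ≠ 1) (hk : k ≠ 0)
    (ε : ℤˣ) (i j : X.Idx) (n : ℕ+) (m : ℤ) : Commute (actCreate ħ V j n) (zOp hV ε i m) := by
  have hn : ((n : ℕ) : ℚ) ≠ 0 := by exact_mod_cast n.ne_zero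
  have hkn := qnum_ne_zero hq (mul_ne_zero hk hn)
  refine commute_dress_of_right _ _ _ _ n
    (commutator_coeff_psExp _ _ _ n _ (create_annih_commutator hV j i n)) (fun m => ?_)
    (fun r => commute_coeff_psExp _ _ _ (create_create_commute hV j i n) r) m
  rw [create_x_commutator hV]
  congr 1
  rw [mul_comm ((n : ℕ) : ℚ) k, Units.val_one, Int.cast_one, mul_one]
  generalize qnum ħ (k * (n : ℕ)) = a at hkn
  field_simp

theorem zOp_mem_vacuum (hq : ∀ n : ℕ, 0 < n → Complex.exp ħ ^ n ≠ 1) (hk : k ≠ 0)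
    (ε : ℤˣ) (i : X.Idx) (m : ℤ) {w : V} (hw : w ∈ vacuum X ħ k V) :
    zOp hV ε i m w ∈ vacuum X ħ k V := by
  rw [mem_vacuum_iff hq hk] at hw ⊢
  intro j n
  rw [← Module.End.mul_apply, (annih_commute_zOp hV hq hk ε i j n m).eq, Module.End.mul_apply,
    hw, map_zero]

theorem fockAct_commute_zOp (hq : ∀ n : ℕ, 0 < n → Complex.exp ħ ^ n ≠ 1) (hk : k ≠ 0)
    (ε : ℤˣ) (i : X.Idx) (m : ℤ) (u : Fock X) :
    Commute (fockAct X ħ V u) (zOp hV ε i m) := by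
  induction u using MvPolynomial.induction_on with
  | C c =>
    rw [← MvPolynomial.algebraMap_eq, AlgHom.commutes]
    exact Algebra.commutes c _
  | add u v hu hv =>
    rw [map_add]
    exact hu.add_left hv
  | mul_X u p hu =>
    rw [map_mul, fockAct_X]
    exact hu.mul_left (create_commute_zOp hV hq hk ε i p.1 p.2 m)

include hV in
theorem fockAct_fockAnnih (i : X.Idx) (n : ℕ+) {w : V}
    (hw : actAnnih ħ V i n w = 0) (u : Fock X) :
    fockAct X ħ V (fockAnnih ħ k i n u) w = actAnnih ħ V i n (fockAct X ħ V u w) := by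
  let s : X.Idx × ℕ+ → ℂ := fun p => if p.2 = n then
    qnum ħ (X.form i p.1 * (n : ℕ)) * qnum ħ ((n : ℕ) * k) / ((n : ℕ) : ℂ) else 0
  have hs : fockAnnih ħ k i n =
      (MvPolynomial.mkDerivation ℂ fun p => (MvPolynomial.C (s p) : Fock X)).toLinearMap := by
    rw [fockAnnih]
    congr 2
    ext1 p
    simp only [s]
    split_ifs
    · rfl
    · exact (map_zero _).symm
  rw [apply_algHom_of_annihilated (s := s) _ hw, hs]
  · rfl
  · intro p
    rw [fockAct_X, annih_create_commutator hV, ite_smul, zero_smul]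

-- For a vacuum vector `w` the map `u ↦ u • w` intertwines the Fock modes with the modes on `V`,
-- hence also their exponentials.
include hV in
theorem fockAct_fockEE (hq : ∀ n : ℕ, 0 < n → Complex.exp ħ ^ n ≠ 1) (hk : k ≠ 0)
    (ε : ℤˣ) (i : X.Idx) (p r : ℕ) (u : Fock X) {w : V} (hw : w ∈ vacuum X ħ k V) :
    fockAct X ħ V (fockEE ħ k ε i p r u) w =
      PowerSeries.coeff p (Eminus ħ k ε (-1) (actCreate ħ V i))
        (PowerSeries.coeff r (Eplus ħ k ε (-1) (actAnnih ħ V i)) (fockAct X ħ V u w)) := by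
  rw [mem_vacuum_iff hq hk] at hw
  let T : Fock X →ₗ[ℂ] V := (LinearMap.applyₗ w) ∘ₗ (fockAct X ħ V).toLinearMap
  have hT : ∀ u, T u = fockAct X ħ V u w := fun _ => rfl
  rw [← hT, ← hT, fockEE, Module.End.mul_apply]
  have h1 := coeff_psExp_intertwine (b := fockAnnih ħ k i) (b' := actAnnih ħ V i) (T := T)
    (fun n => ((ε : ℤ) : ℂ) * (qpow ħ (-(((ε : ℤ) : ℚ) * k * (n : ℕ) / 2)) /
      qnum ħ (k * (n : ℕ))) * (((-1 : ℤˣ) : ℤ) : ℂ))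
    (fun n u => fockAct_fockAnnih hV i n (hw i n) u) r u
  have h2 := fun u => coeff_psExp_intertwine (b := fockCreate i) (b' := actCreate ħ V i) (T := T)
    (fun n => -((ε : ℤ) : ℂ) * (qpow ħ (-(((ε : ℤ) : ℚ) * k * (n : ℕ) / 2)) /
      qnum ħ (k * (n : ℕ))) * (((-1 : ℤˣ) : ℤ) : ℂ))
    (fun n u => by
      rw [hT, hT, fockCreate, LinearMap.mulLeft_apply, map_mul, fockAct_X, Module.End.mul_apply])
    p u
  rw [Eplus, Eplus, Eminus, Eminus, ← h1, ← h2]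

end ZOperators

end QAff

end

/-! ### Assembly -/

theorem theorem2p3 (X : QAff.SimpleType) (ħ : ℂ)
    (hq : ∀ n : ℕ, 0 < n → Complex.exp ħ ^ n ≠ 1)
    (k : ℚ) (hk : k ≠ 0)
    (V : Type*) [AddCommGroup V] [Module ℂ V] [Module (QAff.Uq X ħ) V]
    [IsScalarTower ℂ (QAff.Uq X ħ) V] (hV : QAff.InCategory X ħ k V) :
    -- all sums defining the coefficients of the Z-operators are finite
    (∀ (ε : ℤˣ) (i : X.Idx) (m : ℤ) (v : V),
      (Function.support (QAff.zTerm ħ k V ε i m v)).Finite) ∧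
    ∃ Φ : QAff.Fock X ⊗[ℂ] QAff.vacuum X ħ k V ≃ₗ[ℂ] V,
      (∀ (u : QAff.Fock X) (w : QAff.vacuum X ħ k V),
        Φ (u ⊗ₜ[ℂ] w) = QAff.incl ħ u • (w : V)) ∧
      -- the Z-operators restrict to linear operators on the vacuum space
      ∃ Z : ℤˣ → X.Idx → ℤ → Module.End ℂ (QAff.vacuum X ħ k V),
        (∀ (ε : ℤˣ) (i : X.Idx) (m : ℤ) (w : QAff.vacuum X ħ k V),
          (Z ε i m w : V) = QAff.zCoeff ħ k V ε i m (w : V)) ∧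
        -- the coefficient of `z ^ m` in the factorization of `x_i^ε(z)`
        ∀ (ε : ℤˣ) (i : X.Idx) (m : ℤ) (t : QAff.Fock X ⊗[ℂ] QAff.vacuum X ħ k V),
          (Function.support fun pr : ℕ × ℕ =>
            TensorProduct.map (QAff.fockEE ħ k ε i pr.1 pr.2) (Z ε i (m - pr.1 + pr.2)) t).Finite ∧
          QAff.xCoeff ħ V ε i m (Φ t) =
            Φ (∑ᶠ pr : ℕ × ℕ,
              TensorProduct.map (QAff.fockEE ħ k ε i pr.1 pr.2) (Z ε i (m - pr.1 + pr.2)) t) := by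
  refine ⟨fun ε i m v => QAff.dressTerm_support_finite
    (A := fun p => PowerSeries.coeff p (QAff.Eminus ħ k ε 1 (QAff.actCreate ħ V i)))
    (QAff.locallyBounded_xCoeff hV ε i)
    (QAff.locallyFinite_Eplus hV ε 1 i) m v, ?_⟩
  let Φ := LinearEquiv.ofBijective _ (QAff.fockMap_bijective hV hq hk)
  have hΦ : ∀ u w, Φ (u ⊗ₜ[ℂ] w) = QAff.fockAct X ħ V u (w : V) := fun u w =>
    QAff.fockMap_tmul _ _ u w
  refine ⟨Φ, hΦ, fun ε i m => (QAff.zOp hV ε i m).restrict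
    fun w hw => QAff.zOp_mem_vacuum hV hq hk ε i m hw, fun ε i m w => rfl, fun ε i m t => ?_⟩
  -- On `u ⊗ w` the left side gives `E_- E_+ u Z w`. Since `Z` commutes with `u` and with `E_+`, it
  -- moves between the two exponentials, which is a term of the dressed field.
  have hterm : ∀ pr : ℕ × ℕ,
      Φ (TensorProduct.map (QAff.fockEE ħ k ε i pr.1 pr.2)
        ((QAff.zOp hV ε i (m - pr.1 + pr.2)).restrict
          fun w hw => QAff.zOp_mem_vacuum hV hq hk ε i _ hw) t) =
      QAff.dressTerm
        (fun p => PowerSeries.coeff p (QAff.Eminus ħ k ε (-1) (QAff.actCreate ħ V i)))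
        (fun r => PowerSeries.coeff r (QAff.Eplus ħ k ε (-1) (QAff.actAnnih ħ V i)))
        (QAff.zOp hV ε i) m (Φ t) pr := by
    intro pr
    induction t with
    | zero => simp [QAff.dressTerm]
    | add t t' h h' =>
      rw [map_add, map_add, h, h', map_add]
      simp only [QAff.dressTerm, map_add]
    | tmul u w =>
      have h1 : Commute (QAff.zOp hV ε i (m - pr.1 + pr.2))
          (PowerSeries.coeff pr.2 (QAff.Eplus ħ k ε (-1) (QAff.actAnnih ħ V i))) :=
        QAff.commute_coeff_psExp _ _ _
          (fun n => (QAff.annih_commute_zOp hV hq hk ε i i n _).symm) _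
      rw [TensorProduct.map_tmul, hΦ, hΦ, LinearMap.coe_restrict_apply,
        QAff.fockAct_fockEE hV hq hk ε i _ _ _ (QAff.zOp_mem_vacuum hV hq hk ε i _ w.2),
        QAff.dressTerm, ← Module.End.mul_apply (QAff.fockAct X ħ V u),
        (QAff.fockAct_commute_zOp hV hq hk ε i _ u).eq, Module.End.mul_apply,
        ← Module.End.mul_apply (PowerSeries.coeff pr.2 _), ← h1.eq, Module.End.mul_apply]
  have hfin := QAff.dressTerm_support_finite
    (A := fun p => PowerSeries.coeff p (QAff.Eminus ħ k ε (-1) (QAff.actCreate ħ V i)))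
    (QAff.locallyBounded_dress (A := fun p => PowerSeries.coeff p
      (QAff.Eminus ħ k ε 1 (QAff.actCreate ħ V i))) (QAff.locallyBounded_xCoeff hV ε i)
      (QAff.locallyFinite_Eplus hV ε 1 i)) (QAff.locallyFinite_Eplus hV ε (-1) i) m (Φ t)
  have hsupp : (Function.support fun pr : ℕ × ℕ =>
      TensorProduct.map (QAff.fockEE ħ k ε i pr.1 pr.2)
        ((QAff.zOp hV ε i (m - pr.1 + pr.2)).restrict
          fun w hw => QAff.zOp_mem_vacuum hV hq hk ε i _ hw) t).Finite :=
    hfin.subset fun pr hpr h0 => hpr (Φ.map_eq_zero_iff.1 ((hterm pr).trans h0))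
  refine ⟨hsupp, ?_⟩
  rw [← LinearEquiv.coe_toLinearMap Φ, ← LinearMap.toAddMonoidHom_coe Φ.toLinearMap,
    AddMonoidHom.map_finsum _ hsupp]
  refine Eq.trans ?_ (finsum_congr fun pr => (hterm pr).symm)
  -- Dressing `Z` with the exponentials at `-α_i` undoes the dressing at `α_i` that defined it.
  refine (QAff.finsum_dressTerm_dress (QAff.locallyBounded_xCoeff hV ε i)
    (QAff.locallyFinite_Eplus hV ε 1 i) (QAff.locallyFinite_Eplus hV ε (-1) i)
    (fun n => ?_) (fun n => ?_) m (Φ t)).symm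
  · rw [← PowerSeries.coeff_mul, QAff.Eminus_neg_mul, PowerSeries.coeff_one]
  · rw [← PowerSeries.coeff_mul, QAff.Eplus_mul_neg, PowerSeries.coeff_one]
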